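/- Let $G=\mathbb Z/2\mathbb Z\star\mathbb Z/3\mathbb Z$, let $a$ and $b$ be generators of the two factors and $\Sigma=\{a,b,b^2\}$. Every $g\in G$ has a unique normal form, a word over $\Sigma$ representing $g$ with no two consecutive letters in the same factor ($\{a\}$ or $\{b,b^2\}$); let $|g|$ be the word length of $g$ with respect to $\Sigma$. Let $p,q\ge 0$ with $0<p+q<1$, set $r=1-p-q$, and let $\mu$ be the probability measure on $\Sigma$ with $\mu(a)=r$, $\mu(b)=p$, $\mu(b^2)=q$. Let $X_n=\xi_0\xi_1\cdots\xi_{n-1}$, where the $\xi_i$ are independent with law $\mu$. (1) The Traffic Equations $$\begin{aligned}x(a)&=r\,(x(b)+x(b^2))+q\,x(b)+p\,x(b^2),\\ x(b)&=p\,x(a)+q\,x(b^2)+r\,\frac{x(a)x(b)}{x(b)+x(b^2)},\\ x(b^2)&=q\,x(a)+p\,x(b)+r\,\frac{x(a)x(b^2)}{x(b)+x(b^2)}\end{aligned}$$ have exactly one solution $x$ with positive entries and $x(a)+x(b)+x(b^2)=1$. With $$\Delta_1=\sqrt{p^4+q^4-2p^3-2q^3+2p^2q^2-6p^2q-6pq^2+5p^2+5q^2+6pq},\qquad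 \Delta_2=p^2+q^2-pq-2p-2q+4,$$ it is given by $$x(a)=\frac{p^2+q^2-2pq-p-q+4-\Delta_1}{2\Delta_2}$$ and, if $p\ne q$, $$x(b)=\frac{q^3-3q^2+p^2q-5pq+2p+6q-(2-q)\Delta_1}{2(q-p)\Delta_2},\qquad x(b^2)=\frac{p^3-3p^2+pq^2-5pq+6p+2q-(2-p)\Delta_1}{2(p-q)\Delta_2},$$ while $x(b)=x(b^2)=\frac1{2(2-p)}$ if $p=q$. (2) Almost surely, $|X_n|/n\to\gamma$ with $$\gamma=\gamma(r,p,q)=\frac{2r\Bigl(pq-p-q+\sqrt{(p^2+q^2)(3+(r+p)^2+(r+q)^2)+2pq(2r+1)}\Bigr)}{(r+p)^2+(r+q)^2-pq+2}.$$ (3) Almost surely, the normal forms of $X_n$ converge letter by letter to an infinite word $X_\infty\in\Sigma^{\mathbb N}$. The law $\mu^\infty$ of $X_\infty$ (the harmonic measure) is the Markovian multiplicative measure associated with the solution $x$ of (1): the probability that $X_\infty$ starts with $u_1\cdots u_k$ is $x(u_1)\prod_{i=1}^{k-1}P(u_i,u_{i+1})$, where $P(u,v)=0$ if $u,v$ are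 in the same factor, and otherwise $P(u,v)=x(v)/\sum_w x(w)$, the sum being over the letters $w$ not in the factor of $u$. The harmonic measure is never invariant under the shift $w_0w_1w_2\cdots\mapsto w_1w_2\cdots$ of $\Sigma^{\mathbb N}$. (4) The polynomial $z^6+12z^4-4z^3+47z^2-48z+12$ has exactly one root $z_0$ in $(0.490275,\,0.4902755)$. Over all $(p,q)$ as above, the drift is maximal exactly for $(r,p,q)=(z_0,1-z_0,0)$ and $(r,p,q)=(z_0,0,1-z_0)$, and its maximal value $\gamma_{\max}$ satisfies $|\gamma_{\max}-0.163379|<5\cdot10^{-7}$. -/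

import Mathlib

open MeasureTheory ProbabilityTheory Filter Topology

noncomputable section

namespace ModularWalk

/-- The group `ℤ/2ℤ ⋆ ℤ/3ℤ` (the modular group), as a free product. -/
abbrev G : Type := Monoid.Coprod (Multiplicative (ZMod 2)) (Multiplicative (ZMod 3))

/-- The countable group `G` carries the discrete σ-algebra. -/
instance : MeasurableSpace G := ⊤

/-- The generating alphabet `Σ = {a, b, b²}`, the union of the two factors without the identity. -/
inductive Letter where
  | a
  | b
  | b2
  deriving DecidableEq

instance : Fintype Letter := ⟨{.a, .b, .b2}, fun x => by cases x <;> simp⟩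

/-- The finite alphabet carries the discrete σ-algebra. -/
instance : MeasurableSpace Letter := ⊤

/-- The generator `a` of the factor `ℤ/2ℤ`. -/
def genA : G := Monoid.Coprod.inl (Multiplicative.ofAdd 1)

/-- The generator `b` of the factor `ℤ/3ℤ`. -/
def genB : G := Monoid.Coprod.inr (Multiplicative.ofAdd 1)

/-- The group element represented by a letter. -/
def Letter.toG : Letter → G
  | .a => genA
  | .b => genB
  | .b2 => genB ^ 2

/-- The group element represented by a finite word. -/
def evalWord (l : List Letter) : G := (l.map Letter.toG).prod

/-- Word length with respect to `Σ`: the least length of a word over `Σ` representing `g`. -/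
def wordLength (g : G) : ℕ := sInf {n | ∃ l : List Letter, l.length = n ∧ evalWord l = g}

/-- The two letters belong to the same factor (`{a}` or `{b, b²}`). -/
def SameFactor (u v : Letter) : Prop := u = .a ↔ v = .a

instance (u v : Letter) : Decidable (SameFactor u v) := by unfold SameFactor; infer_instance

/-- `l` is the normal form of `g`: it represents `g` and consecutive letters
come from different factors. -/
def IsNormalForm (l : List Letter) (g : G) : Prop :=
  evalWord l = g ∧ l.IsChain (fun u v => ¬ SameFactor u v)

/-! ### Nearest-neighbour random walks -/

/-- `p = μ(b)`, `q = μ(b²)`, `μ(a) = 1 - p - q` are the weights of a probability measure on `Σ`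
whose support generates the group. -/
def Admissible (p q : ℝ) : Prop := 0 ≤ p ∧ 0 ≤ q ∧ 0 < p + q ∧ p + q < 1

/-- The step law `μ` on `G`: `μ(a) = 1 - p - q`, `μ(b) = p`, `μ(b²) = q`. -/
def stepLaw (p q : ℝ) : Measure G :=
  ENNReal.ofReal (1 - p - q) • Measure.dirac genA
    + ENNReal.ofReal p • Measure.dirac genB
    + ENNReal.ofReal q • Measure.dirac (genB ^ 2)

/-- The increments `ξ₀, ξ₁, …` are independent with common law `μ`. -/
structure IsStepSequence {Ω : Type*} [MeasurableSpace Ω] (p q : ℝ) (P : Measure Ω)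
    (ξ : ℕ → Ω → G) : Prop where
  measurable : ∀ n, Measurable (ξ n)
  law : ∀ n, P.map (ξ n) = stepLaw p q
  indep : iIndepFun ξ P

/-- The random walk `X₀ = 1`, `Xₙ = ξ₀ ξ₁ ⋯ ξₙ₋₁`. -/
def walk {Ω : Type*} (ξ : ℕ → Ω → G) (n : ℕ) (ω : Ω) : G :=
  ((List.range n).map (fun i => ξ i ω)).prod

/-- `γ` is the drift of the process `X`: almost surely `|Xₙ| / n → γ`. -/
def HasDrift {Ω : Type*} [MeasurableSpace Ω] (P : Measure Ω) (X : ℕ → Ω → G) (γ : ℝ) : Prop :=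
  ∀ᵐ ω ∂P, Tendsto (fun n : ℕ => (wordLength (X n ω) : ℝ) / n) atTop (𝓝 γ)

/-! ### Harmonic measure -/

/-- The sequence `g` of group elements converges to the infinite word `w`:
for each `k`, from some time on, the `k`-th letter of the normal form of `gₙ` exists and is `wₖ`. -/
def ConvergesToWord (g : ℕ → G) (w : ℕ → Letter) : Prop :=
  ∀ k, ∀ᶠ n in atTop, ∃ l, IsNormalForm l (g n) ∧ l[k]? = some (w k)

/-- `ν` is the harmonic measure of the process `X`: the law on `Σ^ℕ` of the almost sure limit
`X_∞` of the normal forms of `Xₙ`. -/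
def IsHarmonicMeasure {Ω : Type*} [MeasurableSpace Ω] (P : Measure Ω) (X : ℕ → Ω → G)
    (ν : Measure (ℕ → Letter)) : Prop :=
  ∃ Xinf : Ω → ℕ → Letter, Measurable Xinf ∧
    (∀ᵐ ω ∂P, ConvergesToWord (fun n => X n ω) (Xinf ω)) ∧ P.map Xinf = ν

/-- The shift `w₀ w₁ w₂ … ↦ w₁ w₂ …`. -/
def shift (w : ℕ → Letter) : ℕ → Letter := fun n => w (n + 1)

/-- The cylinder of infinite words with prefix `l`. -/
def cylinder (l : List Letter) : Set (ℕ → Letter) :=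
  {w | ∀ (i : ℕ) (h : i < l.length), w i = l[i]}

/-- Transition probabilities of the Markovian multiplicative measure attached to `x`:
`0` within a factor, else `x(v)` divided by the mass of the letters outside the factor of `u`. -/
def transition (x : Letter → ℝ) (u v : Letter) : ℝ :=
  if SameFactor u v then 0 else x v / ∑ w with ¬ SameFactor u w, x w

/-- Product of the transition probabilities along `u l₀ l₁ …`. -/
def pathWeight (x : Letter → ℝ) : Letter → List Letter → ℝ
  | _, [] => 1
  | u, v :: l => transition x u v * pathWeight x v l

/-- Mass of a cylinder: initial law `x`, then the transition probabilities. -/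
def cylinderWeight (x : Letter → ℝ) : List Letter → ℝ
  | [] => 1
  | u :: l => x u * pathWeight x u l

/-- `ν` is the Markovian multiplicative measure associated with `x`. -/
def IsMarkovMultiplicative (x : Letter → ℝ) (ν : Measure (ℕ → Letter)) : Prop :=
  ∀ l : List Letter, ν (cylinder l) = ENNReal.ofReal (cylinderWeight x l)

/-! ### Traffic Equations and closed forms -/

/-- The Traffic Equations of the walk. -/
def TrafficEquations (p q : ℝ) (x : Letter → ℝ) : Prop :=
  x .a = (1 - p - q) * (x .b + x .b2) + q * x .b + p * x .b2 ∧
  x .b = p * x .a + q * x .b2 + (1 - p - q) * (x .a * x .b / (x .b + x .b2)) ∧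
  x .b2 = q * x .a + p * x .b + (1 - p - q) * (x .a * x .b2 / (x .b + x .b2))

/-- `x` is a probability vector on `Σ` with positive entries. -/
def PositiveProbability (x : Letter → ℝ) : Prop :=
  (∀ u, 0 < x u) ∧ ∑ u, x u = 1

def Delta1 (p q : ℝ) : ℝ :=
  √(p ^ 4 + q ^ 4 - 2 * p ^ 3 - 2 * q ^ 3 + 2 * p ^ 2 * q ^ 2 - 6 * p ^ 2 * q - 6 * p * q ^ 2
    + 5 * p ^ 2 + 5 * q ^ 2 + 6 * p * q)

def Delta2 (p q : ℝ) : ℝ := p ^ 2 + q ^ 2 - p * q - 2 * p - 2 * q + 4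

/-- The explicit solution of the Traffic Equations. -/
def trafficSolution (p q : ℝ) : Letter → ℝ
  | .a => (p ^ 2 + q ^ 2 - 2 * p * q - p - q + 4 - Delta1 p q) / (2 * Delta2 p q)
  | .b =>
      if p = q then 1 / (2 * (2 - p)) else
        (q ^ 3 - 3 * q ^ 2 + p ^ 2 * q - 5 * p * q + 2 * p + 6 * q - (2 - q) * Delta1 p q)
          / (2 * (q - p) * Delta2 p q)
  | .b2 =>
      if p = q then 1 / (2 * (2 - p)) else
        (p ^ 3 - 3 * p ^ 2 + p * q ^ 2 - 5 * p * q + 6 * p + 2 * q - (2 - p) * Delta1 p q)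
          / (2 * (p - q) * Delta2 p q)

/-- The closed form of the drift, in terms of `r = μ(a)`, `p = μ(b)`, `q = μ(b²)`. -/
def driftFormula (r p q : ℝ) : ℝ :=
  2 * r * (p * q - p - q
      + √((p ^ 2 + q ^ 2) * (3 + (r + p) ^ 2 + (r + q) ^ 2) + 2 * p * q * (2 * r + 1)))
    / ((r + p) ^ 2 + (r + q) ^ 2 - p * q + 2)

end ModularWalk

end

noncomputable section

namespace ModularWalk

/-! ### The Traffic Equations -/

/-! Traffic Equations. The first equation and the normalisation are linear in x(b), x(b²). For p ≠ q
they give (q-p)x(b) = (2-q)x(a) - (1-q) and the mirror identity, and the second equation then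
becomes a quadratic in u = x(a) with discriminant `Delta1`². Its roots sum to at least 1, so at most
one lies below 1/2. Positivity of x(b) and x(b²) selects that root (`eq_trafficSolution_a`,
`trafficSolution_sub_pos`).

Drift. Let y be a random infinite word with the Markovian multiplicative law of x. The Traffic
Equations say that this law is stationary under μ. Averaging a functional of g·y over y therefore
gives a function of g whose mean along one step is computable (`wordValue_harmonic`). For the
Busemann version of the length it grows by exactly r(1-2x(a)) + p(x(a)-x(b²)) + q(x(a)-x(b)), which
the first equation turns into 2r(1-2x(a)), the drift formula. The averaged function stays within
bounded distance of the length (`abs_lengthValue_sub_length_le`), so the length is, up to a bounded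
error, nγ plus a martingale with bounded increments. A second moment bound along the squares and
interpolation give the almost sure limit.

Harmonic measure. Since x(a) < 1/2 the drift is positive and the length tends to infinity. A step
alters only the end of the normal form, so prefixes stabilise. The probability that g·y starts with
t is harmonic in g, equals the cylinder weight at g = 1, and tends to the indicator of the limit
word along the walk; dominated convergence identifies the law. Shift invariance would force
x(b)+x(b²) ≤ x(a), against x(a) < 1/2.

Maximum. For fixed r the drift depends on p, q only through pq and is largest at pq = 0
(`driftFormula_lt_boundaryDrift`). What remains is one variable: a concave numerator over a convex
denominator, whose critical equation squares to the sextic. -/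

theorem Admissible.symm {p q : ℝ} (h : Admissible p q) : Admissible q p :=
  ⟨h.2.1, h.1, by linarith [h.2.2.1], by linarith [h.2.2.2]⟩

theorem Delta1_comm (p q : ℝ) : Delta1 p q = Delta1 q p := by
  unfold Delta1; congr 1; ring

theorem Delta2_comm (p q : ℝ) : Delta2 p q = Delta2 q p := by
  unfold Delta2; ring

theorem trafficSolution_a_comm (p q : ℝ) : trafficSolution p q .a = trafficSolution q p .a := by
  simp only [trafficSolution, Delta1_comm p q, Delta2_comm p q]; congr 1; ring

theorem sum_letter (x : Letter → ℝ) : ∑ u, x u = x .a + x .b + x .b2 := by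
  rw [show (Finset.univ : Finset Letter) = {.a, .b, .b2} from rfl]
  simp [add_assoc]

theorem Delta2_pos {p q : ℝ} (h : Admissible p q) : 0 < Delta2 p q := by
  obtain ⟨hp, hq, h0, h1⟩ := h
  unfold Delta2
  nlinarith [sq_nonneg (p - q)]

/-- `Delta1` is the square root of the discriminant of the quadratic satisfied by x(a). The radicand
regroups into nonnegative terms, so the real square root is genuine. -/
theorem Delta1_sq {p q : ℝ} (h : Admissible p q) :
    Delta1 p q ^ 2 = (p ^ 2 + q ^ 2 - 2 * p * q - p - q + 4) ^ 2
      - 4 * Delta2 p q * (1 - p * q) := by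
  obtain ⟨hp, hq, h0, h1⟩ := h
  unfold Delta1 Delta2
  rw [Real.sq_sqrt]
  · ring
  · have : p ^ 4 + q ^ 4 - 2 * p ^ 3 - 2 * q ^ 3 + 2 * p ^ 2 * q ^ 2 - 6 * p ^ 2 * q - 6 * p * q ^ 2
      + 5 * p ^ 2 + 5 * q ^ 2 + 6 * p * q = (p ^ 2 + q ^ 2) * (3 + (1 - q) ^ 2 + (1 - p) ^ 2)
        + 2 * (p * q) * (2 * (1 - p - q) + 1) := by ring
    rw [this]
    have h2 : 0 ≤ p * q := mul_nonneg hp hq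
    have h3 : 0 ≤ 1 - p - q := by linarith
    positivity

/-- This is x(a) < 1/2, hence positivity of the drift, in disguise. In s = p+q and m = pq the
difference of squares is a polynomial controlled by m ≤ s²/4. -/
theorem Delta1_gt {p q : ℝ} (h : Admissible p q) : p + q - p * q < Delta1 p q := by
  have hsq := Delta1_sq h
  have h0 : 0 ≤ Delta1 p q := Real.sqrt_nonneg _
  obtain ⟨hp, hq, hs, h1⟩ := h
  refine lt_of_pow_lt_pow_left₀ 2 h0 ?_
  rw [hsq]
  unfold Delta2
  obtain ⟨s, hs'⟩ : ∃ s, s = p + q := ⟨_, rfl⟩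
  obtain ⟨m, hm'⟩ : ∃ m, m = p * q := ⟨_, rfl⟩
  have hm : m ≤ s ^ 2 / 4 := by subst hs' hm'; nlinarith [sq_nonneg (p - q)]
  have hm0 : 0 ≤ m := by subst hm'; positivity
  have key : 0 < s ^ 2 * (4 - 2 * s + s ^ 2) - m * (4 + 4 * s ^ 2 - 2 * s) + 3 * m ^ 2 := by
    have hs0 : 0 < s := by linarith
    have hs1 : s < 1 := by linarith
    have h2 : m * (4 + 4 * s ^ 2 - 2 * s) ≤ s ^ 2 / 4 * (4 + 4 * s ^ 2 - 2 * s) :=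
      mul_le_mul_of_nonneg_right hm (by nlinarith)
    have h3 : 0 < s ^ 2 * (3 - 3 / 2 * s) := by
      apply mul_pos (by positivity); linarith
    nlinarith [sq_nonneg m]
  subst hs' hm'
  linarith

theorem one_sub_two_mul_trafficSolution_a {p q : ℝ} (h : Admissible p q) :
    1 - 2 * trafficSolution p q .a = (p * q - p - q + Delta1 p q) / Delta2 p q := by
  have := (Delta2_pos h).ne'
  simp only [trafficSolution]
  field_simp
  unfold Delta2
  ring

theorem trafficSolution_a_lt_half {p q : ℝ} (h : Admissible p q) :
    trafficSolution p q .a < 1 / 2 := by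
  have h1 := one_sub_two_mul_trafficSolution_a h
  have h2 : 0 < (p * q - p - q + Delta1 p q) / Delta2 p q :=
    div_pos (by linarith [Delta1_gt h]) (Delta2_pos h)
  linarith

theorem trafficSolution_a_quadratic {p q : ℝ} (h : Admissible p q) :
    Delta2 p q * trafficSolution p q .a ^ 2
      - (p ^ 2 + q ^ 2 - 2 * p * q - p - q + 4) * trafficSolution p q .a + (1 - p * q) = 0 := by
  have h2 := (Delta2_pos h).ne'
  have hsq := Delta1_sq h
  simp only [trafficSolution]
  field_simp
  linear_combination hsq

theorem eq_trafficSolution_a {p q : ℝ} (h : Admissible p q) {t : ℝ} (ht : t < 1 / 2)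
    (hQ : Delta2 p q * t ^ 2 - (p ^ 2 + q ^ 2 - 2 * p * q - p - q + 4) * t + (1 - p * q) = 0) :
    t = trafficSolution p q .a := by
  have h2 := Delta2_pos h
  have hα := trafficSolution_a_lt_half h
  have hQ' := trafficSolution_a_quadratic h
  obtain ⟨hp, hq, hs, h1⟩ := h
  set u := trafficSolution p q .a
  have h3 : (t - u) * (Delta2 p q * (t + u) - (p ^ 2 + q ^ 2 - 2 * p * q - p - q + 4)) = 0 := by
    linear_combination hQ - hQ'
  rcases mul_eq_zero.1 h3 with h4 | h4
  · linarith
  · exfalso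
    -- Two distinct roots below 1/2 would sum to less than 1, but the sum of the roots times
    -- `Delta2` is `Delta2` + p + q - pq.
    have h5 : Delta2 p q * (t + u) < Delta2 p q * 1 := mul_lt_mul_of_pos_left (by linarith) h2
    unfold Delta2 at h4 h5
    nlinarith [mul_nonneg hp hq]

theorem trafficSolution_a_pos {p q : ℝ} (h : Admissible p q) : 0 < trafficSolution p q .a := by
  have h2 := Delta2_pos h
  have hα := trafficSolution_a_lt_half h
  have hQ' := trafficSolution_a_quadratic h
  obtain ⟨hp, hq, hs, h1⟩ := h
  set u := trafficSolution p q .a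
  have h5 : Delta2 p q * u < Delta2 p q * (1 / 2) := mul_lt_mul_of_pos_left (by linarith) h2
  by_contra hu
  push Not at hu
  have h6 : Delta2 p q * u < (p ^ 2 + q ^ 2 - 2 * p * q - p - q + 4) := by
    unfold Delta2 at h5 ⊢
    nlinarith [sq_nonneg (p - q), mul_nonneg hp hq]
  have h7 : 0 < 1 - p * q := by nlinarith
  nlinarith

/-- Evaluating the quadratic at (1-q)/(2-q) gives (q-p)(p+q-pq)/(2-q)². Subtracting its value 0 at
x(a) and factoring shows that (2-q)x(a) - (1-q) has the sign of q-p. -/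
theorem trafficSolution_sub_pos {p q : ℝ} (h : Admissible p q) (hpq : p ≠ q) :
    0 < ((2 - q) * trafficSolution p q .a - (1 - q)) / (q - p) := by
  have h2 := Delta2_pos h
  have hα := trafficSolution_a_lt_half h
  have hQ' := trafficSolution_a_quadratic h
  obtain ⟨hp, hq, hs, h1⟩ := h
  set u := trafficSolution p q .a
  have h2q : 0 < 2 - q := by linarith
  have hfac : ((2 - q) * u - (1 - q)) * ((2 - q) * (p ^ 2 + q ^ 2 - 2 * p * q - p - q + 4)
      - Delta2 p q * ((1 - q) + (2 - q) * u)) = (q - p) * (p + q - p * q) := by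
    have : (1 - q) ^ 2 * Delta2 p q
        - (p ^ 2 + q ^ 2 - 2 * p * q - p - q + 4) * ((1 - q) * (2 - q)) + (1 - p * q) * (2 - q) ^ 2
        = (q - p) * (p + q - p * q) := by unfold Delta2; ring
    linear_combination this - (2 - q) ^ 2 * hQ'
  have hB : 0 < (2 - q) * (p ^ 2 + q ^ 2 - 2 * p * q - p - q + 4)
      - Delta2 p q * ((1 - q) + (2 - q) * u) := by
    have h5 : Delta2 p q * ((1 - q) + (2 - q) * u) < Delta2 p q * (2 - q) := by
      apply mul_lt_mul_of_pos_left _ h2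
      nlinarith
    have h6 : Delta2 p q ≤ (p ^ 2 + q ^ 2 - 2 * p * q - p - q + 4) := by
      unfold Delta2; nlinarith
    nlinarith
  have hC : 0 < p + q - p * q := by nlinarith
  have hne : q - p ≠ 0 := sub_ne_zero.2 hpq.symm
  have : ((2 - q) * u - (1 - q)) / (q - p) * ((2 - q) * (p ^ 2 + q ^ 2 - 2 * p * q - p - q + 4)
      - Delta2 p q * ((1 - q) + (2 - q) * u)) = (p + q - p * q) := by
    field_simp
    linear_combination hfac
  exact pos_of_mul_pos_left (this ▸ hC) hB.le

theorem trafficSolution_b_of_ne {p q : ℝ} (h : Admissible p q) (hpq : p ≠ q) :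
    trafficSolution p q .b = ((2 - q) * trafficSolution p q .a - (1 - q)) / (q - p) := by
  have h2 := (Delta2_pos h).ne'
  have hne : q - p ≠ 0 := sub_ne_zero.2 hpq.symm
  simp only [trafficSolution, if_neg hpq]
  field_simp
  unfold Delta2
  ring

theorem trafficSolution_b2_of_ne {p q : ℝ} (h : Admissible p q) (hpq : p ≠ q) :
    trafficSolution p q .b2 = ((2 - p) * trafficSolution p q .a - (1 - p)) / (p - q) := by
  have h2 := (Delta2_pos h).ne'
  have hne : p - q ≠ 0 := sub_ne_zero.2 hpq
  simp only [trafficSolution, if_neg hpq]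
  field_simp
  unfold Delta2
  ring

theorem trafficSolution_a_self {p : ℝ} (h : Admissible p p) :
    trafficSolution p p .a = (1 - p) / (2 - p) := by
  have h' := h
  obtain ⟨hp, hq, hs, h1⟩ := h
  have h2 : 0 < 2 - p := by linarith
  symm
  apply eq_trafficSolution_a h'
  · rw [div_lt_div_iff₀ h2 two_pos]; linarith
  · unfold Delta2
    field_simp
    ring

theorem trafficSolution_positiveProbability {p q : ℝ} (h : Admissible p q) :
    PositiveProbability (trafficSolution p q) := by
  have ha := trafficSolution_a_pos h
  by_cases hpq : p = q
  · subst hpq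
    have haa := trafficSolution_a_self h
    have h2 : 0 < 2 - p := by linarith [h.2.2.2, h.1]
    have hb : trafficSolution p p .b = 1 / (2 * (2 - p)) := by simp [trafficSolution]
    have hb2 : trafficSolution p p .b2 = 1 / (2 * (2 - p)) := by simp [trafficSolution]
    refine ⟨?_, ?_⟩
    · rintro (_ | _ | _)
      · exact ha
      · rw [hb]; positivity
      · rw [hb2]; positivity
    · rw [sum_letter, haa, hb, hb2]; field_simp; ring
  · have hb := trafficSolution_b_of_ne h hpq
    have hb2 := trafficSolution_b2_of_ne h hpq
    refine ⟨?_, ?_⟩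
    · rintro (_ | _ | _)
      · exact ha
      · rw [hb]; exact trafficSolution_sub_pos h hpq
      · rw [hb2, trafficSolution_a_comm]; exact trafficSolution_sub_pos h.symm (Ne.symm hpq)
    · have h1 : q - p ≠ 0 := sub_ne_zero.2 (Ne.symm hpq)
      have h2 : p - q ≠ 0 := sub_ne_zero.2 hpq
      rw [sum_letter, hb, hb2, ← neg_sub q p, div_neg]
      field_simp
      ring

theorem trafficSolution_trafficEquations {p q : ℝ} (h : Admissible p q) :
    TrafficEquations p q (trafficSolution p q) := by
  obtain ⟨hpos, hsum⟩ := trafficSolution_positiveProbability h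
  rw [sum_letter] at hsum
  have ha := hpos .a
  have hb := hpos .b
  have hc := hpos .b2
  by_cases hpq : p = q
  · subst hpq
    have haa := trafficSolution_a_self h
    have h2 : 0 < 2 - p := by linarith [h.2.2.2, h.1]
    have hb : trafficSolution p p .b = 1 / (2 * (2 - p)) := by simp [trafficSolution]
    have hb2 : trafficSolution p p .b2 = 1 / (2 * (2 - p)) := by simp [trafficSolution]
    refine ⟨?_, ?_, ?_⟩ <;> rw [haa, hb, hb2] <;> field_simp <;> ring
  · have hb' := trafficSolution_b_of_ne h hpq
    have hQ := trafficSolution_a_quadratic h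
    have h1 : q - p ≠ 0 := sub_ne_zero.2 (Ne.symm hpq)
    unfold TrafficEquations
    clear hpos
    generalize trafficSolution p q .a = u at *
    generalize trafficSolution p q .b = v at *
    generalize trafficSolution p q .b2 = w at *
    have hv : (q - p) * v = (2 - q) * u - (1 - q) := by rw [hb']; field_simp
    have hw : w = 1 - u - v := by linarith
    have hvw : v + w = 1 - u := by linarith
    have hu : 1 - u ≠ 0 := by linarith
    subst hw
    unfold Delta2 at hQ
    -- Multiplied by q-p, the second equation is the quadratic for u once v is eliminated. The third
    -- follows from this one and the linear relation.
    have e1 : v * (1 - u) = (p * u + q * (1 - u - v)) * (1 - u) + (1 - p - q) * (u * v) := by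
      apply mul_left_cancel₀ h1
      linear_combination (1 - u + q * (1 - u) - (1 - p - q) * u) * hv - hQ
    refine ⟨by linear_combination -hv, ?_, ?_⟩
    · rw [hvw]; field_simp; linear_combination e1
    · rw [hvw]; field_simp; linear_combination -e1 + (1 - u) * hv

theorem trafficEquations_unique {p q : ℝ} (h : Admissible p q) {x : Letter → ℝ}
    (hx : PositiveProbability x) (ht : TrafficEquations p q x) : x = trafficSolution p q := by
  obtain ⟨hpos, hsum⟩ := hx
  rw [sum_letter] at hsum
  have ha := hpos .a
  have hb := hpos .b
  have hc := hpos .b2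
  obtain ⟨t1, t2, t3⟩ := ht
  obtain ⟨u, hu⟩ : ∃ u, u = x .a := ⟨_, rfl⟩
  obtain ⟨v, hv⟩ : ∃ v, v = x .b := ⟨_, rfl⟩
  obtain ⟨w, hw⟩ : ∃ w, w = x .b2 := ⟨_, rfl⟩
  rw [← hu, ← hv, ← hw] at hsum t1 t2 t3
  rw [← hu] at ha
  rw [← hv] at hb
  rw [← hw] at hc
  have hvw : 0 < v + w := by linarith
  have hvw' : v + w = 1 - u := by linarith
  suffices u = trafficSolution p q .a ∧ v = trafficSolution p q .b ∧ w = trafficSolution p q .b2 by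
    funext l
    cases l
    · rw [← hu, this.1]
    · rw [← hv, this.2.1]
    · rw [← hw, this.2.2]
  have e2 : v * (v + w) = (p * u + q * w) * (v + w) + (1 - p - q) * (u * v) := by
    field_simp at t2; linear_combination t2
  have e3 : w * (v + w) = (q * u + p * v) * (v + w) + (1 - p - q) * (u * w) := by
    field_simp at t3; linear_combination t3
  obtain ⟨hp, hq, hs, h1⟩ := id h
  by_cases hpq : p = q
  · subst hpq
    have h2 : 0 < 2 - p := by linarith
    have hU : u = (1 - p) / (2 - p) := by
      rw [eq_div_iff h2.ne']; linear_combination t1 + (1 - p) * hsum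
    have hVW : v = w := by
      -- When p = q the linear relations do not separate v from w; the difference of the last two
      -- equations does, since its other factor is positive.
      have : (v - w) * ((1 + p) * (v + w) - (1 - p - p) * u) = 0 := by
        linear_combination e2 - e3
      have hne : 0 < (1 + p) * (v + w) - (1 - p - p) * u := by
        have : (2 - p) * u = 1 - p := by rw [hU]; field_simp
        have hu2 : u ≤ 1 / 2 := by nlinarith
        rw [hvw']
        nlinarith
      rcases mul_eq_zero.1 this with h | h <;> linarith
    have hV : v = 1 / (2 * (2 - p)) := by
      have : (2 - p) * u = 1 - p := by rw [hU]; field_simp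
      rw [eq_div_iff (by positivity)]
      subst hVW
      linear_combination (2 - p) * hsum - this
    refine ⟨by rw [trafficSolution_a_self h, hU], ?_, ?_⟩
    · simp only [trafficSolution, if_true]; exact hV
    · simp only [trafficSolution, if_true]; exact hVW ▸ hV
  · have h3 : q - p ≠ 0 := sub_ne_zero.2 (Ne.symm hpq)
    have h4 : p - q ≠ 0 := sub_ne_zero.2 hpq
    have hV : (q - p) * v = (2 - q) * u - (1 - q) := by
      linear_combination -t1 + (p - 1 + q - p) * hsum
    have hW : (p - q) * w = (2 - p) * u - (1 - p) := by
      linear_combination -t1 + (q - 1 + p - q) * hsum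
    -- The positive coordinate to use depends on the order: w > 0 gives u < (1-p)/(2-p) if p < q,
    -- and v > 0 gives the mirror bound otherwise.
    have hhalf : u < 1 / 2 := by
      rcases lt_or_gt_of_ne hpq with hlt | hlt
      · nlinarith [mul_pos (sub_pos.2 hlt) hc]
      · nlinarith [mul_pos (sub_pos.2 hlt) hb]
    have hU : u = trafficSolution p q .a := by
      apply eq_trafficSolution_a h hhalf
      unfold Delta2
      have hw' : w = 1 - u - v := by linarith
      subst hw'
      linear_combination (1 - u + q * (1 - u) - (1 - p - q) * u) * hV - (q - p) * e2
    refine ⟨hU, ?_, ?_⟩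
    · rw [trafficSolution_b_of_ne h hpq, ← hU, eq_div_iff h3]; linear_combination hV
    · rw [trafficSolution_b2_of_ne h hpq, ← hU, eq_div_iff h4]; linear_combination hW

theorem driftFormula_eq {p q : ℝ} (h : Admissible p q) :
    driftFormula (1 - p - q) p q = 2 * (1 - p - q) * (1 - 2 * trafficSolution p q .a) := by
  rw [one_sub_two_mul_trafficSolution_a h, driftFormula, mul_div_assoc]
  have e1 : (1 - p - q + p) ^ 2 + (1 - p - q + q) ^ 2 - p * q + 2 = Delta2 p q := by
    unfold Delta2; ring
  have e2 : √((p ^ 2 + q ^ 2) * (3 + (1 - p - q + p) ^ 2 + (1 - p - q + q) ^ 2)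
      + 2 * p * q * (2 * (1 - p - q) + 1)) = Delta1 p q := by
    unfold Delta1; congr 1; ring
  rw [e1, e2]

theorem driftFormula_pos {p q : ℝ} (h : Admissible p q) :
    0 < driftFormula (1 - p - q) p q := by
  rw [driftFormula_eq h]
  have := trafficSolution_a_lt_half h
  have h1 := h.2.2.2
  exact mul_pos (by linarith) (by linarith)

/-! ### Maximisation of the drift -/

/-- The drift of the walk with weights `μ(a) = r` and `μ(b) = 1 - r`, `μ(b²) = 0`. -/
def boundaryDrift (r : ℝ) : ℝ := 2 * r * (1 - r) / (1 + √(r ^ 2 + 4))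

theorem driftFormula_comm (r p q : ℝ) : driftFormula r p q = driftFormula r q p := by
  unfold driftFormula
  congr 1
  · congr 1; congr 1
    · ring
    · congr 1; ring
  · ring

/-- At q = 0 the radicand is p²(r²+4) and the denominator is S²-1 with S = √(r²+4), so a factor S-1
cancels. -/
theorem driftFormula_boundary {p : ℝ} (hp : 0 ≤ p) :
    driftFormula (1 - p) p 0 = boundaryDrift (1 - p) := by
  unfold driftFormula boundaryDrift
  have hS : √((1 - p) ^ 2 + 4) ^ 2 = (1 - p) ^ 2 + 4 := Real.sq_sqrt (by positivity)
  have hS0 : 0 ≤ √((1 - p) ^ 2 + 4) := Real.sqrt_nonneg _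
  have e : √((p ^ 2 + 0 ^ 2) * (3 + (1 - p + p) ^ 2 + (1 - p + 0) ^ 2)
      + 2 * p * 0 * (2 * (1 - p) + 1)) = p * √((1 - p) ^ 2 + 4) := by
    rw [← Real.sqrt_sq hp, ← Real.sqrt_mul (sq_nonneg p), Real.sqrt_sq hp]
    congr 1; ring
  rw [e]
  have h1 : (1 - p + p) ^ 2 + (1 - p + 0) ^ 2 - p * 0 + 2 ≠ 0 := by
    have : (1 - p + p) ^ 2 + (1 - p + 0) ^ 2 - p * 0 + 2 = 3 + (1 - p) ^ 2 := by ring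
    rw [this]; positivity
  have h2 : 1 + √((1 - p) ^ 2 + 4) ≠ 0 := by positivity
  rw [div_eq_div_iff h1 h2]
  linear_combination 2 * (1 - p) * p * hS

-- With s = p+q and m = pq the radicand is s²S² - 4m(1+s²) + 4m², where S = √(r²+4). The claim
-- becomes an upper bound for its square root that is linear in m, with equality at m = 0.
set_option maxHeartbeats 800000 in
theorem driftFormula_lt_boundaryDrift {p q : ℝ} (hp : 0 < p) (hq : 0 < q) (h1 : p + q < 1) :
    driftFormula (1 - p - q) p q < boundaryDrift (1 - p - q) := by
  have hA : Admissible p q := ⟨hp.le, hq.le, by linarith, h1⟩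
  have hD := Delta2_pos hA
  obtain ⟨s, hs⟩ : ∃ s, s = p + q := ⟨_, rfl⟩
  obtain ⟨m, hm⟩ : ∃ m, m = p * q := ⟨_, rfl⟩
  obtain ⟨S, hS⟩ : ∃ S, S = √((1 - p - q) ^ 2 + 4) := ⟨_, rfl⟩
  have hS2 : S ^ 2 = (1 - s) ^ 2 + 4 := by
    rw [hS, Real.sq_sqrt (by positivity), hs]; ring
  have hS0 : 0 ≤ S := by rw [hS]; positivity
  have hs0 : 0 < s := by linarith
  have hs1 : s < 1 := by linarith
  have hm0 : 0 < m := by rw [hm]; positivity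
  have hm4 : m ≤ s ^ 2 / 4 := by rw [hs, hm]; nlinarith [sq_nonneg (p - q)]
  have hSge : 2 ≤ S := by nlinarith [sq_nonneg (1 - s)]
  have hSle : S ≤ 2 + (1 - s) ^ 2 / 4 := by nlinarith [sq_nonneg ((1 - s) ^ 2)]
  -- Solving for equality with the boundary drift gives sS - mk as the value the square root must
  -- stay below; this fixes k.
  obtain ⟨k, hk⟩ : ∃ k, k = 1 + 3 * s / (S + 1) := ⟨_, rfl⟩
  have hkS : k * (S + 1) = S + 1 + 3 * s := by rw [hk]; field_simp
  have hk1 : 1 ≤ k := by rw [hk]; have : 0 ≤ 3 * s / (S + 1) := by positivity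
                         linarith
  have hks : k ≤ 1 + s := by nlinarith
  have hpos : 0 < s * S - m * k := by
    have : m * k ≤ s ^ 2 / 4 * 2 := by
      apply mul_le_mul hm4 (by linarith) (by linarith) (by positivity)
    nlinarith
  -- The squared inequality, divided by m, is affine in m, so the worst case is m = s²/4, which is
  -- this expression. It is bounded below by replacing S with 2+(1-s)²/4 and then k with 1+s, in
  -- which it is decreasing.
  have hkey : 0 < 4 + 3 * s ^ 2 + s ^ 2 * k ^ 2 / 4 - 2 * s * S * k := by
    have h0 : 2 * s * S * k ≤ 2 * s * (2 + (1 - s) ^ 2 / 4) * k := by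
      gcongr
    have hf : 0 < (1 - s) * (4 - s / 2 - 3 / 4 * s ^ 2 + s ^ 3 / 4) := by
      have : s ^ 2 ≤ 1 := by nlinarith
      have : 0 ≤ s ^ 3 := by positivity
      exact mul_pos (by linarith) (by linarith)
    have hg : 0 ≤ (1 + s - k) * (s * (2 * (2 + (1 - s) ^ 2 / 4) - s * (k + 1 + s) / 4)) := by
      refine mul_nonneg (by linarith) (mul_nonneg hs0.le ?_)
      have : s * (k + 1 + s) ≤ 1 * 4 :=
        mul_le_mul hs1.le (by linarith) (by linarith) zero_le_one
      nlinarith [sq_nonneg (1 - s)]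
    linarith
  have hk4 : 0 ≤ 4 - k ^ 2 := by
    have : k ^ 2 ≤ 2 ^ 2 := pow_le_pow_left₀ (by linarith) (by linarith) 2
    linarith
  have hR : s ^ 2 * S ^ 2 - 4 * m * (1 + s ^ 2) + 4 * m ^ 2 < (s * S - m * k) ^ 2 := by
    have h2 : m * (4 - k ^ 2) ≤ s ^ 2 / 4 * (4 - k ^ 2) :=
      mul_le_mul_of_nonneg_right hm4 hk4
    have h3 : 0 < m * (4 + 4 * s ^ 2 - 2 * s * S * k - m * (4 - k ^ 2)) :=
      mul_pos hm0 (by linarith)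
    linarith
  have hsqrt : √((p ^ 2 + q ^ 2) * (3 + (1 - p - q + p) ^ 2 + (1 - p - q + q) ^ 2)
      + 2 * p * q * (2 * (1 - p - q) + 1)) < s * S - m * k := by
    rw [Real.sqrt_lt' hpos]
    refine lt_of_eq_of_lt ?_ hR
    rw [hS2, hs, hm]; ring
  unfold driftFormula boundaryDrift
  rw [← hS]
  have e1 : (1 - p - q + p) ^ 2 + (1 - p - q + q) ^ 2 - p * q + 2 = Delta2 p q := by
    unfold Delta2; ring
  rw [e1, div_lt_div_iff₀ hD (by linarith)]
  have hr : 0 < 2 * (1 - p - q) := by linarith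
  have e2 : Delta2 p q = S ^ 2 - 1 - 3 * m := by rw [hS2, hs, hm]; unfold Delta2; ring
  have e3 : (m - s + (s * S - m * k)) * (1 + S) = s * (S ^ 2 - 1 - 3 * m) := by
    linear_combination -m * hkS
  rw [e2]
  have h5 : p * q - p - q + √((p ^ 2 + q ^ 2) * (3 + (1 - p - q + p) ^ 2 + (1 - p - q + q) ^ 2)
      + 2 * p * q * (2 * (1 - p - q) + 1)) < m - s + (s * S - m * k) := by
    rw [hm, hs] at *; linarith
  have h6 := mul_lt_mul_of_pos_right h5 (show 0 < 1 + S by linarith)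
  rw [e3] at h6
  have h7 := mul_lt_mul_of_pos_left h6 hr
  calc _ = _ := by ring
    _ < _ := h7
    _ = _ := by rw [hs]; ring

/-- The polynomial whose root is the drift-maximising weight of `a`. -/
theorem exists_unique_root : ∃ z₀ : ℝ, (0.490275 < z₀ ∧ z₀ < 0.4902755) ∧
    ∀ z : ℝ, 0.490275 < z → z < 0.4902755 →
      (z ^ 6 + 12 * z ^ 4 - 4 * z ^ 3 + 47 * z ^ 2 - 48 * z + 12 = 0 ↔ z = z₀) := by
  have hc : ContinuousOn (fun z : ℝ => z ^ 6 + 12 * z ^ 4 - 4 * z ^ 3 + 47 * z ^ 2 - 48 * z + 12)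
      (Set.Icc 0.490275 0.4902755) := by fun_prop
  have h := intermediate_value_Ioo (by norm_num) hc
  obtain ⟨z₀, hz, hz0⟩ := h (show (0 : ℝ) ∈ _ by constructor <;> norm_num)
  simp only at hz0
  refine ⟨z₀, hz, fun z h1 h2 => ⟨fun h => ?_, fun h => h ▸ hz0⟩⟩
  obtain ⟨h3, h4⟩ := hz
  have hfac : (z - z₀) * (z ^ 5 + z ^ 4 * z₀ + z ^ 3 * z₀ ^ 2 + z ^ 2 * z₀ ^ 3 + z * z₀ ^ 4 + z₀ ^ 5
      + 12 * (z ^ 3 + z ^ 2 * z₀ + z * z₀ ^ 2 + z₀ ^ 3) - 4 * (z ^ 2 + z * z₀ + z₀ ^ 2)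
      + 47 * (z + z₀) - 48) = 0 := by linear_combination h - hz0
  have hz' : 0 < z := by linarith
  have hz0' : 0 < z₀ := by linarith
  rcases mul_eq_zero.1 hfac with h5 | h5
  · linarith
  -- The divided difference is positive: the cubic terms (about 5.66) outweigh the negative
  -- contributions -4(z²+zz₀+z₀²) and 47(z+z₀)-48.
  · exfalso
    have a1 : z ^ 2 ≤ 0.4902755 ^ 2 := by gcongr
    have a2 : z₀ ^ 2 ≤ 0.4902755 ^ 2 := by gcongr
    have a3 : z * z₀ ≤ 0.4902755 * 0.4902755 := by gcongr
    have a4 : (0.490275 : ℝ) ^ 3 ≤ z ^ 3 := by gcongr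
    have a5 : (0.490275 : ℝ) ^ 3 ≤ z₀ ^ 3 := by gcongr
    have a6 : (0.490275 : ℝ) ^ 2 * 0.490275 ≤ z ^ 2 * z₀ := by gcongr
    have a7 : (0.490275 : ℝ) * 0.490275 ^ 2 ≤ z * z₀ ^ 2 := by gcongr
    have a8 : 0 < z ^ 5 + z ^ 4 * z₀ + z ^ 3 * z₀ ^ 2 + z ^ 2 * z₀ ^ 3 + z * z₀ ^ 4 + z₀ ^ 5 := by
      positivity
    norm_num at *
    linarith

/-- With M the value at z, numerator minus M times denominator is strictly concave in r, vanishes at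
z and is critical there. The convexity of √(r²+4) enters only through its tangent at z, and the
numerator is exactly quadratic, so the maximum is global and strict. -/
theorem boundaryDrift_lt_of_root {z r : ℝ} (h1 : 0.490275 < z) (h2 : z < 0.4902755)
    (hz : z ^ 6 + 12 * z ^ 4 - 4 * z ^ 3 + 47 * z ^ 2 - 48 * z + 12 = 0) (hr : r ≠ z) :
    boundaryDrift r < boundaryDrift z := by
  unfold boundaryDrift
  obtain ⟨S, hS⟩ : ∃ S, S = √(z ^ 2 + 4) := ⟨_, rfl⟩
  obtain ⟨T, hT⟩ : ∃ T, T = √(r ^ 2 + 4) := ⟨_, rfl⟩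
  rw [← hS, ← hT]
  have hS2 : S ^ 2 = z ^ 2 + 4 := by rw [hS, Real.sq_sqrt (by positivity)]
  have hT2 : T ^ 2 = r ^ 2 + 4 := by rw [hT, Real.sq_sqrt (by positivity)]
  have hS0 : 0 < S := by rw [hS]; positivity
  have hT0 : 0 < T := by rw [hT]; positivity
  have hcube : (0.490275 : ℝ) ^ 3 ≤ z ^ 3 := by gcongr
  -- The sextic is the square of the critical equation; on this interval both sides are nonnegative,
  -- so the square can be undone.
  have hcrit : (1 - 2 * z) * S = z ^ 3 + 8 * z - 4 := by
    refine (pow_left_inj₀ (n := 2) (mul_nonneg (by linarith) hS0.le) ?_ two_ne_zero).1 ?_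
    · norm_num at *; linarith
    · linear_combination (1 - 2 * z) ^ 2 * hS2 - hz
  have hcrit2 : (2 - 4 * z) * (1 + S) * S = 2 * z * (1 - z) * z := by
    linear_combination 2 * hcrit + (2 - 4 * z) * hS2
  have htan : S * T ≥ z * r + 4 := by
    have : (z * r + 4) ^ 2 ≤ (S * T) ^ 2 := by
      rw [mul_pow, hS2, hT2]; nlinarith [sq_nonneg (z - r)]
    exact le_of_sq_le_sq this (by positivity)
  rw [div_lt_div_iff₀ (by positivity) (by positivity)]
  have hne : 0 < (r - z) ^ 2 := by
    have := sub_ne_zero.2 hr; positivity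
  have hM : 0 < 2 * z * (1 - z) := mul_pos (by linarith) (by linarith)
  have h3 : 2 * z * (1 - z) * (z * r + 4) ≤ 2 * z * (1 - z) * (S * T) :=
    mul_le_mul_of_nonneg_left htan hM.le
  have h4 : 0 < S * (1 + S) * (r - z) ^ 2 := by positivity
  refine lt_of_mul_lt_mul_left ?_ hS0.le
  have e : S * (2 * r * (1 - r) * (1 + S)) = 2 * z * (1 - z) * (S + (z * r + 4))
      - 2 * (S * (1 + S) * (r - z) ^ 2) := by
    linear_combination (r - z) * hcrit2 + 2 * z * (1 - z) * hS2
  nlinarith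

theorem boundaryDrift_approx {z : ℝ} (h1 : 0.490275 < z) (h2 : z < 0.4902755) :
    |boundaryDrift z - 0.163379| < 0.0000005 := by
  unfold boundaryDrift
  have hS1 : 2.059215 < √(z ^ 2 + 4) := by
    apply Real.lt_sqrt_of_sq_lt; nlinarith
  have hS2 : √(z ^ 2 + 4) < 2.059217 := by
    rw [Real.sqrt_lt' (by norm_num)]; nlinarith
  rw [abs_lt, lt_sub_iff_add_lt, sub_lt_iff_lt_add, lt_div_iff₀ (by positivity),
    div_lt_iff₀ (by positivity)]
  constructor <;> nlinarith

theorem driftFormula_maximal {z : ℝ} (h1 : 0.490275 < z) (h2 : z < 0.4902755)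
    (hz : z ^ 6 + 12 * z ^ 4 - 4 * z ^ 3 + 47 * z ^ 2 - 48 * z + 12 = 0) {p q : ℝ}
    (h : Admissible p q) :
    driftFormula (1 - p - q) p q ≤ driftFormula z (1 - z) 0 ∧
    (driftFormula (1 - p - q) p q = driftFormula z (1 - z) 0 ↔
      (p = 1 - z ∧ q = 0) ∨ (p = 0 ∧ q = 1 - z)) := by
  have hz0 : driftFormula z (1 - z) 0 = boundaryDrift z := by
    have := driftFormula_boundary (p := 1 - z) (by linarith)
    rwa [sub_sub_cancel] at this
  rw [hz0]
  have hmax : ∀ r, boundaryDrift r ≤ boundaryDrift z := fun r => by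
    by_cases hr : r = z
    · rw [hr]
    · exact (boundaryDrift_lt_of_root h1 h2 hz hr).le
  have hside : ∀ t, 0 ≤ t → (boundaryDrift (1 - t) = boundaryDrift z ↔ t = 1 - z) := by
    intro t _
    constructor
    · intro he
      by_contra hne
      exact (boundaryDrift_lt_of_root h1 h2 hz (r := 1 - t)
        (fun h => hne (by linarith))).ne he
    · rintro rfl; rw [sub_sub_cancel]
  have hz1 : 1 - z ≠ 0 := by linarith
  obtain ⟨hp, hq, hs, hs1⟩ := h
  rcases hp.eq_or_lt with rfl | hp'
  · rw [sub_zero, driftFormula_comm, driftFormula_boundary hq, hside q hq]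
    exact ⟨hmax _, by simp [hz1.symm]⟩
  · rcases hq.eq_or_lt with rfl | hq'
    · rw [sub_zero, driftFormula_boundary hp, hside p hp]
      exact ⟨hmax _, by simp [hz1.symm]⟩
    · have := (driftFormula_lt_boundaryDrift hp' hq' hs1).trans_le (hmax _)
      exact ⟨this.le, by simp [this.ne, hp'.ne', hq'.ne']⟩

/-! ### Normal forms -/

/-- Left multiplication of a normal form by a letter (and, for reversed normal forms, right
multiplication). -/
def push : Letter → List Letter → List Letter
  | .a, .a :: l => l
  | .b, .b :: l => .b2 :: l
  | .b, .b2 :: l => l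
  | .b2, .b :: l => l
  | .b2, .b2 :: l => .b :: l
  | s, l => s :: l

/-- Consecutive letters of the word come from different factors. -/
abbrev Reduced (l : List Letter) : Prop := l.IsChain (fun u v => ¬ SameFactor u v)

theorem genA_mul_genA : genA * genA = 1 := by
  rw [genA, ← map_mul, ← ofAdd_add, show (1 + 1 : ZMod 2) = 0 from rfl, ofAdd_zero, map_one]

theorem genB_pow_three : genB ^ 3 = 1 := by
  rw [genB, ← map_pow, ← ofAdd_nsmul, show (3 • 1 : ZMod 3) = 0 from rfl, ofAdd_zero, map_one]

@[simp]
theorem evalWord_nil : evalWord [] = 1 := rfl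

@[simp]
theorem evalWord_cons (s : Letter) (l : List Letter) :
    evalWord (s :: l) = s.toG * evalWord l := by simp [evalWord]

theorem evalWord_append (l l' : List Letter) :
    evalWord (l ++ l') = evalWord l * evalWord l' := by simp [evalWord]

theorem evalWord_push (s : Letter) (l : List Letter) :
    evalWord (push s l) = s.toG * evalWord l := by
  have h2 := genA_mul_genA
  have h3 := genB_pow_three
  have h3' : genB * (genB * genB) = 1 := by rw [← pow_three, h3]
  rcases s <;> rcases l with _ | ⟨_ | _ | _, l⟩ <;>
    simp only [push, evalWord_cons, Letter.toG, ← mul_assoc, h2, one_mul, pow_two]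
  · rw [mul_assoc genB, h3', one_mul]
  · rw [mul_assoc genB, h3', one_mul]
  · rw [mul_assoc genB, h3', one_mul]

/-- The same `push` serves right multiplication of the reversed word because each factor is abelian:
merging two letters of a factor does not depend on their order. -/
theorem evalWord_reverse_push (s : Letter) (l : List Letter) :
    evalWord (push s l).reverse = evalWord l.reverse * s.toG := by
  have h2 := genA_mul_genA
  have h3 := genB_pow_three
  have h3' : genB * (genB * genB) = 1 := by rw [← pow_three, h3]
  rcases s <;> rcases l with _ | ⟨_ | _ | _, l⟩ <;>
    simp [push, evalWord_append, Letter.toG, mul_assoc, h2, h3', pow_two]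

theorem reduced_push (s : Letter) {l : List Letter} (h : Reduced l) : Reduced (push s l) := by
  rcases s <;> rcases l with _ | ⟨_ | _ | _, _ | ⟨_ | _ | _, l⟩⟩ <;>
    simp_all [push, Reduced, SameFactor]

theorem push_of_reduced {s : Letter} {l : List Letter} (h : Reduced (s :: l)) :
    push s l = s :: l := by
  rcases s <;> rcases l with _ | ⟨_ | _ | _, l⟩ <;> simp_all [push, SameFactor]

theorem push_a_push_a {l : List Letter} (h : Reduced l) : push .a (push .a l) = l := by
  rcases l with _ | ⟨_ | _ | _, _ | ⟨_ | _ | _, l⟩⟩ <;> simp_all [push, SameFactor]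

theorem push_b_push_b {l : List Letter} (h : Reduced l) : push .b (push .b l) = push .b2 l := by
  rcases l with _ | ⟨_ | _ | _, _ | ⟨_ | _ | _, l⟩⟩ <;> simp_all [push, SameFactor]

theorem push_b_push_b2 {l : List Letter} (h : Reduced l) : push .b (push .b2 l) = l := by
  rcases l with _ | ⟨_ | _ | _, _ | ⟨_ | _ | _, l⟩⟩ <;> simp_all [push, SameFactor]

theorem push_b2_push_b {l : List Letter} (h : Reduced l) : push .b2 (push .b l) = l := by
  rcases l with _ | ⟨_ | _ | _, _ | ⟨_ | _ | _, l⟩⟩ <;> simp_all [push, SameFactor]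

/-- `push a` as a permutation of the reduced words. -/
def permA : Equiv.Perm {l : List Letter // Reduced l} where
  toFun l := ⟨push .a l.1, reduced_push _ l.2⟩
  invFun l := ⟨push .a l.1, reduced_push _ l.2⟩
  left_inv l := Subtype.ext (push_a_push_a l.2)
  right_inv l := Subtype.ext (push_a_push_a l.2)

/-- `push b` as a permutation of the reduced words. -/
def permB : Equiv.Perm {l : List Letter // Reduced l} where
  toFun l := ⟨push .b l.1, reduced_push _ l.2⟩
  invFun l := ⟨push .b2 l.1, reduced_push _ l.2⟩
  left_inv l := Subtype.ext (push_b2_push_b l.2)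
  right_inv l := Subtype.ext (push_b_push_b2 l.2)

theorem permA_sq : permA ^ 2 = 1 := by
  ext1 l
  exact Subtype.ext (push_a_push_a l.2)

theorem permB_sq_apply (l : {l : List Letter // Reduced l}) :
    ((permB ^ 2) l).1 = push .b2 l.1 := push_b_push_b l.2

theorem permB_cube : permB ^ 3 = 1 := by
  ext1 l
  rw [pow_succ', Equiv.Perm.mul_apply]
  refine Subtype.ext ?_
  change push .b ((permB ^ 2) l).1 = l.1
  rw [permB_sq_apply, push_b_push_b2 l.2]

/-- The homomorphism from `ℤ/nℤ` attached to an element whose `n`-th power is `1`. -/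
def cyclicHom {M : Type*} [Monoid M] {n : ℕ} [NeZero n] {x : M} (hx : x ^ n = 1) :
    Multiplicative (ZMod n) →* M where
  toFun z := x ^ (Multiplicative.toAdd z).val
  map_one' := by simp
  map_mul' z w := by
    rw [toAdd_mul, ZMod.val_add, ← pow_eq_pow_mod _ hx, pow_add]

/-- The action of `G` on reduced words by left multiplication. -/
def wordAction : G →* Equiv.Perm {l : List Letter // Reduced l} :=
  Monoid.Coprod.lift (cyclicHom permA_sq) (cyclicHom permB_cube)

theorem wordAction_genA : wordAction genA = permA := by
  simp [wordAction, genA, cyclicHom, ZMod.val_one]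

theorem wordAction_genB : wordAction genB = permB := by
  have : (1 : ZMod 3).val = 1 := rfl
  simp [wordAction, genB, cyclicHom, this]

theorem wordAction_toG (s : Letter) (l : {l : List Letter // Reduced l}) :
    (wordAction s.toG l).1 = push s l.1 := by
  cases s
  · simp only [Letter.toG, wordAction_genA]; rfl
  · simp only [Letter.toG, wordAction_genB]; rfl
  · simp only [Letter.toG, map_pow, wordAction_genB, permB_sq_apply]

/-- The normal form of a group element. -/
def normalForm (g : G) : List Letter := (wordAction g ⟨[], List.IsChain.nil⟩).1

theorem reduced_normalForm (g : G) : Reduced (normalForm g) := (wordAction g _).2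

theorem normalForm_one : normalForm 1 = [] := by simp [normalForm]

theorem normalForm_toG_mul (s : Letter) (g : G) :
    normalForm (s.toG * g) = push s (normalForm g) := by
  rw [normalForm, map_mul, Equiv.Perm.mul_apply, wordAction_toG]; rfl

theorem evalWord_surjective : Function.Surjective evalWord := by
  intro g
  induction g using Monoid.Coprod.induction_on with
  | inl z =>
    induction z using Multiplicative.rec with | _ z
    fin_cases z
    · exact ⟨[], (map_one _).symm⟩
    · exact ⟨[.a], mul_one _⟩
  | inr z =>
    induction z using Multiplicative.rec with | _ z
    fin_cases z
    · exact ⟨[], (map_one _).symm⟩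
    · exact ⟨[.b], mul_one _⟩
    · exact ⟨[.b2], by
        simp only [evalWord_cons, Letter.toG, genB, ← map_pow, evalWord_nil, mul_one]; rfl⟩
  | mul g h hg hh =>
    obtain ⟨l, rfl⟩ := hg
    obtain ⟨l', rfl⟩ := hh
    exact ⟨l ++ l', evalWord_append l l'⟩

instance : Countable G := evalWord_surjective.countable

instance : DiscreteMeasurableSpace G := ⟨fun _ => trivial⟩

instance : DiscreteMeasurableSpace Letter := ⟨fun _ => trivial⟩

theorem evalWord_normalForm (g : G) : evalWord (normalForm g) = g := by
  obtain ⟨l, rfl⟩ := evalWord_surjective g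
  induction l with
  | nil => rw [evalWord_nil, normalForm_one, evalWord_nil]
  | cons s l ih => rw [evalWord_cons, normalForm_toG_mul, evalWord_push, ih]

/-- Uniqueness of normal forms by van der Waerden's argument: letting a reduced word act on the
empty word never cancels anything, so the action of its value rebuilds the word. -/
theorem normalForm_evalWord {l : List Letter} (h : Reduced l) : normalForm (evalWord l) = l := by
  induction l with
  | nil => exact normalForm_one
  | cons s l ih => rw [evalWord_cons, normalForm_toG_mul, ih h.tail, push_of_reduced h]

theorem isNormalForm_iff {l : List Letter} {g : G} : IsNormalForm l g ↔ l = normalForm g := by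
  constructor
  · rintro ⟨rfl, h⟩; exact (normalForm_evalWord h).symm
  · rintro rfl; exact ⟨evalWord_normalForm g, reduced_normalForm g⟩

theorem length_push_le (s : Letter) (l : List Letter) : (push s l).length ≤ l.length + 1 := by
  rcases s <;> rcases l with _ | ⟨_ | _ | _, l⟩ <;> simp [push] <;> lia

theorem le_length_push (s : Letter) (l : List Letter) : l.length ≤ (push s l).length + 1 := by
  rcases s <;> rcases l with _ | ⟨_ | _ | _, l⟩ <;> simp [push]

/-- A letter lengthens the normal form by at most one, so no word is shorter than the normal form of
its value. -/
theorem wordLength_eq (g : G) : wordLength g = (normalForm g).length := by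
  apply le_antisymm
  · exact Nat.sInf_le ⟨_, rfl, evalWord_normalForm g⟩
  · refine le_csInf ⟨_, _, rfl, evalWord_normalForm g⟩ ?_
    rintro n ⟨l, rfl, rfl⟩
    induction l with
    | nil => rw [evalWord_nil, normalForm_one]
    | cons s l ih =>
      rw [evalWord_cons, normalForm_toG_mul, List.length_cons]
      exact (length_push_le _ _).trans (by omega)

/-- The reversed normal form of a group element. -/
def stack (g : G) : List Letter := (normalForm g).reverse

theorem stack_one : stack 1 = [] := by simp [stack, normalForm_one]

theorem length_stack (g : G) : (stack g).length = wordLength g := by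
  rw [stack, List.length_reverse, wordLength_eq]

theorem reduced_reverse {l : List Letter} (h : Reduced l) : Reduced l.reverse := by
  rw [Reduced, List.isChain_reverse]
  exact h.imp fun u v huv hvu => huv (by unfold SameFactor at *; tauto)

theorem stack_mul_toG (g : G) (s : Letter) : stack (g * s.toG) = push s (stack g) := by
  have h1 : Reduced (push s (stack g)).reverse :=
    reduced_reverse (reduced_push s (reduced_reverse (reduced_normalForm g)))
  have h2 : evalWord (push s (stack g)).reverse = g * s.toG := by
    rw [evalWord_reverse_push, stack, List.reverse_reverse, evalWord_normalForm]
  rw [stack, ← h2, normalForm_evalWord h1, List.reverse_reverse]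

/-- A step touches only the top of the stack, that is, the last letter of the normal form. This
makes prefixes stabilise once the length stays large. -/
theorem take_reverse_push (s : Letter) {l : List Letter} {k : ℕ} (h : k < l.length) :
    (push s l).reverse.take k = l.reverse.take k := by
  obtain ⟨v, l, rfl⟩ : ∃ v l', l = v :: l' := by
    cases l with
    | nil => simp at h
    | cons v l => exact ⟨v, l, rfl⟩
  have : ∃ t, push s (v :: l) = t ++ l := by
    rcases s <;> rcases v
    · exact ⟨[], rfl⟩
    · exact ⟨[.a, .b], rfl⟩
    · exact ⟨[.a, .b2], rfl⟩
    · exact ⟨[.b, .a], rfl⟩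
    · exact ⟨[.b2], rfl⟩
    · exact ⟨[], rfl⟩
    · exact ⟨[.b2, .a], rfl⟩
    · exact ⟨[], rfl⟩
    · exact ⟨[.b], rfl⟩
  obtain ⟨t, ht⟩ := this
  have hk : k ≤ l.reverse.length := by simpa [Nat.lt_succ_iff] using h
  rw [ht, List.reverse_append, List.reverse_cons, List.take_append_of_le_length hk,
    List.take_append_of_le_length hk]

/-! ### Harmonic functions

For a random infinite word `y` with the Markovian multiplicative law attached to `x`, and a
functional of `g · y` given by its values `TA` and `TB` when `y` starts with `a`, resp. with `b` or
`b²`, and nothing cancels, `condValue` gives the conditional expectations for all `g`. -/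

theorem push_b2_push_b2 {l : List Letter} (h : Reduced l) : push .b2 (push .b2 l) = push .b l := by
  rcases l with _ | ⟨_ | _ | _, _ | ⟨_ | _ | _, l⟩⟩ <;> simp_all [push, SameFactor]

/-- Probability of the letter `v` among `b`, `b²`. -/
def branch (x : Letter → ℝ) (v : Letter) : ℝ := x v / (x .b + x .b2)

/-- Conditional expectations given that the infinite word starts with `a`, resp. with `b` or `b²`,
as functions of the reversed word; each letter of the infinite word costs `e`. -/
def condValue (x : Letter → ℝ) (e : ℝ) (TA TB : List Letter → ℝ) : List Letter → ℝ × ℝ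
  | [] => (TA [], TB [])
  | .a :: l => ((condValue x e TA TB l).2 - e, TB (.a :: l))
  | .b :: l => (TA (.b :: l),
      branch x .b * (TA (.b2 :: l) - e) + branch x .b2 * ((condValue x e TA TB l).1 - e))
  | .b2 :: l => (TA (.b2 :: l),
      branch x .b * ((condValue x e TA TB l).1 - e) + branch x .b2 * (TA (.b :: l) - e))

/-- Expectation of the functional as a function of the reversed word. -/
def wordValue (x : Letter → ℝ) (e : ℝ) (TA TB : List Letter → ℝ) (l : List Letter) : ℝ :=
  x .a * (condValue x e TA TB l).1 + (x .b + x .b2) * (condValue x e TA TB l).2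

section Harmonic

variable {x : Letter → ℝ} {e : ℝ} {TA TB : List Letter → ℝ}

/-- If y = a·y', then g·y = ga·y' with y' starting with b or b², and the removed letter costs e. The
hypothesis is this same relation in the absence of cancellation. -/
theorem condValue_fst (hA : ∀ l, TA l = TB (.a :: l) - e) (l : List Letter) :
    (condValue x e TA TB l).1 = (condValue x e TA TB (push .a l)).2 - e := by
  rcases l with _ | ⟨_ | _ | _, l⟩ <;> simp [condValue, push, hA]

theorem condValue_snd
    (hB : ∀ l, TB l = branch x .b * (TA (.b :: l) - e) + branch x .b2 * (TA (.b2 :: l) - e))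
    (l : List Letter) :
    (condValue x e TA TB l).2 = branch x .b * ((condValue x e TA TB (push .b l)).1 - e)
      + branch x .b2 * ((condValue x e TA TB (push .b2 l)).1 - e) := by
  rcases l with _ | ⟨_ | _ | _, l⟩ <;> simp [condValue, push, hB]

/-- Stationarity of the law of y under μ, tested on functionals of g·y. The e-term counts the
expected change in the number of letters of y under one step on the left. -/
theorem wordValue_harmonic {p q : ℝ} (hx : PositiveProbability x) (ht : TrafficEquations p q x)
    (hA : ∀ l, TA l = TB (.a :: l) - e)
    (hB : ∀ l, TB l = branch x .b * (TA (.b :: l) - e) + branch x .b2 * (TA (.b2 :: l) - e))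
    {l : List Letter} (hl : Reduced l) :
    (1 - p - q) * wordValue x e TA TB (push .a l) + p * wordValue x e TA TB (push .b l)
      + q * wordValue x e TA TB (push .b2 l)
      = wordValue x e TA TB l + 2 * (1 - p - q) * (1 - 2 * x .a) * e := by
  obtain ⟨hpos, hsum⟩ := hx
  rw [sum_letter] at hsum
  obtain ⟨t1, t2, t3⟩ := ht
  have hβ : 0 < x .b + x .b2 := add_pos (hpos _) (hpos _)
  have h1 := condValue_fst (x := x) hA l
  have h2 := condValue_fst (x := x) hA (push .a l)
  have h3 := condValue_snd hB l
  have h4 := condValue_snd hB (push .b l)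
  have h5 := condValue_snd hB (push .b2 l)
  rw [push_a_push_a hl] at h2
  rw [push_b_push_b hl, push_b2_push_b hl] at h4
  rw [push_b_push_b2 hl, push_b2_push_b2 hl] at h5
  have b1 : (x .b + x .b2) * branch x .b = x .b := by unfold branch; field_simp
  have b2 : (x .b + x .b2) * branch x .b2 = x .b2 := by unfold branch; field_simp
  have t2' : x .b = p * x .a + q * x .b2 + (1 - p - q) * (x .a * branch x .b) := by
    unfold branch; rw [← mul_div_assoc]; exact t2
  have t3' : x .b2 = q * x .a + p * x .b + (1 - p - q) * (x .a * branch x .b2) := by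
    unfold branch; rw [← mul_div_assoc]; exact t3
  unfold wordValue
  generalize (condValue x e TA TB l) = V at *
  generalize (condValue x e TA TB (push .a l)) = Va at *
  generalize (condValue x e TA TB (push .b l)) = Vb at *
  generalize (condValue x e TA TB (push .b2 l)) = Vc at *
  generalize branch x .b = θ at *
  generalize branch x .b2 = θ' at *
  rw [h2, h4, h5, h3, show Va.2 = V.1 + e by linarith]
  -- What is left involves only the values at g, gb and gb² given that y starts with a. Their
  -- coefficients vanish by the first, second and third Traffic Equation respectively.
  linear_combination (-V.1 + e) * t1 + (-Vb.1 + e) * t2' + (-Vc.1 + e) * t3'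
    + p * (Vc.1 - e) * b1 + p * (V.1 - e) * b2 + q * (V.1 - e) * b1 + q * (Vb.1 - e) * b2
    - (Vb.1 - e) * b1 - (Vc.1 - e) * b2 + 2 * (1 - p - q) * e * hsum

theorem branch_add_branch (hx : PositiveProbability x) : branch x .b + branch x .b2 = 1 := by
  have hβ : 0 < x .b + x .b2 := add_pos (hx.1 _) (hx.1 _)
  unfold branch; field_simp

theorem branch_pos (hx : PositiveProbability x) (v : Letter) : 0 < branch x v :=
  div_pos (hx.1 _) (add_pos (hx.1 _) (hx.1 _))

theorem exists_branch_le (hx : PositiveProbability x) :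
    ∃ ρ, 0 ≤ ρ ∧ ρ < 1 ∧ branch x .b ≤ ρ ∧ branch x .b2 ≤ ρ := by
  have h1 := branch_pos hx .b
  have h2 := branch_pos hx .b2
  have h3 := branch_add_branch hx
  refine ⟨max (branch x .b) (branch x .b2), ?_, ?_, le_max_left _ _, le_max_right _ _⟩
  · exact h1.le.trans (le_max_left _ _)
  · exact max_lt (by linarith) (by linarith)

/-! #### Length -/

/-- The Busemann average of the word length, as a function of the reversed word. -/
def lengthValue (x : Letter → ℝ) : List Letter → ℝ :=
  wordValue x 1 (fun l => l.length) (fun l => l.length)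

theorem lengthValue_harmonic {p q : ℝ} (hx : PositiveProbability x) (ht : TrafficEquations p q x)
    {l : List Letter} (hl : Reduced l) :
    (1 - p - q) * lengthValue x (push .a l) + p * lengthValue x (push .b l)
      + q * lengthValue x (push .b2 l)
      = lengthValue x l + 2 * (1 - p - q) * (1 - 2 * x .a) := by
  have := wordValue_harmonic (e := 1) (TA := fun l => l.length) (TB := fun l => l.length) hx ht
    (fun l => by simp)
    (fun l => by simp [← add_mul, branch_add_branch hx]) hl
  rwa [mul_one] at this

/-- The random word cancels past a letter b or b² only with probability at most ρ < 1, so the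
expected cancellation is bounded by a geometric series, uniformly in the word. -/
theorem abs_lengthValue_sub_length_le (hx : PositiveProbability x) :
    ∃ K, ∀ l, |lengthValue x l - l.length| ≤ K := by
  obtain ⟨ρ, hρ0, hρ1, h1, h2⟩ := exists_branch_le hx
  have p1 := branch_pos hx .b
  have p2 := branch_pos hx .b2
  have h12 := branch_add_branch hx
  -- The induction needs 1 + ρ + ρ(K+2) ≤ K, and 1 + 3ρ ≤ 4. The first component is allowed 2 more
  -- because cancelling an a loses a letter on both sides.
  obtain ⟨K, hK⟩ : ∃ K, K = 4 / (1 - ρ) := ⟨_, rfl⟩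
  have hKρ : K * (1 - ρ) = 4 := by rw [hK]; field_simp [show 1 - ρ ≠ 0 by linarith]
  have hK0 : 0 ≤ K := by rw [hK]; exact div_nonneg (by norm_num) (by linarith)
  have key : ∀ l : List Letter,
      (0 ≤ l.length - (condValue x 1 (fun l => l.length) (fun l => l.length) l).1 ∧
        l.length - (condValue x 1 (fun l => l.length) (fun l => l.length) l).1 ≤ K + 2) ∧
      (0 ≤ l.length - (condValue x 1 (fun l => l.length) (fun l => l.length) l).2 ∧
        l.length - (condValue x 1 (fun l => l.length) (fun l => l.length) l).2 ≤ K) := by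
    intro l
    induction l with
    | nil => simp [condValue]; constructor <;> linarith
    | cons s l ih =>
      obtain ⟨⟨i1, i2⟩, i3, i4⟩ := ih
      have aux : ∀ θ, 0 < θ → θ ≤ ρ →
        0 ≤ 1 + θ + θ * (l.length - (condValue x 1 (fun l => l.length) (fun l => l.length) l).1) ∧
        1 + θ + θ * (l.length - (condValue x 1 (fun l => l.length) (fun l => l.length) l).1)
          ≤ K := by
        intro θ h0 hθ
        refine ⟨by positivity, ?_⟩
        have := mul_le_mul hθ i2 i1 hρ0
        nlinarith
      cases s
      · simp only [condValue, List.length_cons, Nat.cast_add, Nat.cast_one]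
        refine ⟨⟨by linarith, by linarith⟩, by linarith, by linarith⟩
      · simp only [condValue, List.length_cons, Nat.cast_add, Nat.cast_one]
        obtain ⟨j1, j2⟩ := aux _ p2 h2
        rw [show branch x .b = 1 - branch x .b2 by linarith]
        refine ⟨⟨by linarith, by linarith⟩, by linarith, by linarith⟩
      · simp only [condValue, List.length_cons, Nat.cast_add, Nat.cast_one]
        obtain ⟨j1, j2⟩ := aux _ p1 h1
        rw [show branch x .b2 = 1 - branch x .b by linarith]
        refine ⟨⟨by linarith, by linarith⟩, by linarith, by linarith⟩
  refine ⟨K + 2, fun l => ?_⟩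
  obtain ⟨⟨i1, i2⟩, i3, i4⟩ := key l
  obtain ⟨hpos, hsum⟩ := hx
  rw [sum_letter] at hsum
  have ha := hpos .a
  have hβ : 0 < x .b + x .b2 := add_pos (hpos _) (hpos _)
  unfold lengthValue wordValue
  generalize (condValue x 1 (fun l => (l.length : ℝ)) (fun l => l.length) l) = V at *
  have e1 : x .a * V.1 + (x .b + x .b2) * V.2 - l.length
      = -(x .a * (l.length - V.1) + (x .b + x .b2) * (l.length - V.2)) := by
    linear_combination (l.length : ℝ) * hsum
  have m1 := mul_le_mul_of_nonneg_left i2 ha.le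
  have m2 := mul_le_mul_of_nonneg_left i4 hβ.le
  rw [e1, abs_neg, abs_of_nonneg (by positivity)]
  nlinarith

/-! #### Cylinders -/

/-- Probability that the word `w`, followed by a random continuation of the letter `u`, has
prefix `t`. -/
def prefixProb (x : Letter → ℝ) (u : Letter) : List Letter → List Letter → ℝ
  | _, [] => 1
  | [], v :: t => pathWeight x u (v :: t)
  | s :: w, v :: t => if s = v then prefixProb x u w t else 0

/-- Probability that the walk started at the given reversed word converges to a word with
prefix `t`. -/
def cylinderValue (x : Letter → ℝ) (t : List Letter) : List Letter → ℝ :=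
  wordValue x 0 (fun l => prefixProb x .b l.reverse t) (fun l => prefixProb x .a l.reverse t)

theorem prefixProb_nil (u : Letter) (t : List Letter) : prefixProb x u [] t = pathWeight x u t := by
  cases t <;> rfl

theorem sum_not_sameFactor_a : ∑ w with ¬ SameFactor .a w, x w = x .b + x .b2 := by
  rw [show (Finset.univ.filter fun w => ¬ SameFactor .a w) = {.b, .b2} by decide]
  simp

theorem sum_not_sameFactor_b : ∑ w with ¬ SameFactor .b w, x w = x .a := by
  rw [show (Finset.univ.filter fun w => ¬ SameFactor .b w) = {.a} by decide]
  simp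

theorem sum_not_sameFactor_b2 : ∑ w with ¬ SameFactor .b2 w, x w = x .a := by
  rw [show (Finset.univ.filter fun w => ¬ SameFactor .b2 w) = {.a} by decide]
  simp

theorem transition_a_a : transition x .a .a = 0 := by simp [transition, SameFactor]

theorem transition_a_b : transition x .a .b = branch x .b := by
  simp only [transition, sum_not_sameFactor_a]; simp [SameFactor, branch]

theorem transition_a_b2 : transition x .a .b2 = branch x .b2 := by
  simp only [transition, sum_not_sameFactor_a]; simp [SameFactor, branch]

theorem transition_b_a (hx : PositiveProbability x) : transition x .b .a = 1 := by
  simp only [transition, sum_not_sameFactor_b]; simp [SameFactor, (hx.1 .a).ne']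

theorem transition_b_b : transition x .b .b = 0 := by simp [transition, SameFactor]

theorem transition_b_b2 : transition x .b .b2 = 0 := by simp [transition, SameFactor]

/-- Both letters b and b² are followed by a with the same probability, so a single continuation law
serves for the whole factor. -/
theorem pathWeight_b2 (t : List Letter) : pathWeight x .b2 t = pathWeight x .b t := by
  cases t with
  | nil => rfl
  | cons v t =>
    simp only [pathWeight, transition, sum_not_sameFactor_b, sum_not_sameFactor_b2]
    simp [SameFactor]

theorem prefixProb_append_a (hx : PositiveProbability x) (w t : List Letter) :
    prefixProb x .b w t = prefixProb x .a (w ++ [.a]) t := by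
  induction t generalizing w with
  | nil => simp [prefixProb]
  | cons v t ih =>
    cases w with
    | nil =>
      cases v <;> simp [prefixProb, prefixProb_nil, pathWeight, transition_b_a hx, transition_b_b,
        transition_b_b2]
    | cons s w => simp [prefixProb, ih]

theorem prefixProb_append_b (hx : PositiveProbability x) (w t : List Letter) :
    prefixProb x .a w t = branch x .b * prefixProb x .b (w ++ [.b]) t
      + branch x .b2 * prefixProb x .b (w ++ [.b2]) t := by
  induction t generalizing w with
  | nil => simp [prefixProb, branch_add_branch hx]
  | cons v t ih =>
    cases w with
    | nil =>
      cases v <;> simp [prefixProb, prefixProb_nil, pathWeight, transition_a_a, transition_a_b,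
        transition_a_b2, pathWeight_b2]
    | cons s w =>
      simp only [prefixProb, List.cons_append]
      split_ifs
      · exact ih w
      · simp

theorem cylinderValue_harmonic {p q : ℝ} (hx : PositiveProbability x)
    (ht : TrafficEquations p q x) (t : List Letter) {l : List Letter} (hl : Reduced l) :
    (1 - p - q) * cylinderValue x t (push .a l) + p * cylinderValue x t (push .b l)
      + q * cylinderValue x t (push .b2 l) = cylinderValue x t l := by
  have := wordValue_harmonic (e := 0) (TA := fun l => prefixProb x .b l.reverse t)
    (TB := fun l => prefixProb x .a l.reverse t) hx ht
    (fun l => by rw [sub_zero, List.reverse_cons, ← prefixProb_append_a hx])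
    (fun l => by simp only [sub_zero, List.reverse_cons, ← prefixProb_append_b hx]) hl
  rwa [mul_zero, add_zero] at this

/-- At g = 1 nothing cancels and g·y = y, so the value is the Markovian weight of the cylinder. -/
theorem cylinderValue_nil (hx : PositiveProbability x) (t : List Letter) :
    cylinderValue x t [] = cylinderWeight x t := by
  have hβ : 0 < x .b + x .b2 := add_pos (hx.1 _) (hx.1 _)
  have hsum := hx.2
  rw [sum_letter] at hsum
  simp only [cylinderValue, wordValue, condValue, List.reverse_nil, prefixProb_nil]
  rcases t with _ | ⟨_ | _ | _, t⟩
  · simp only [pathWeight, cylinderWeight]; linarith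
  · simp [pathWeight, cylinderWeight, transition_b_a hx, transition_a_a]
  · simp only [pathWeight, cylinderWeight, transition_b_b, transition_a_b, branch]; field_simp
    ring
  · simp only [pathWeight, cylinderWeight, transition_b_b2, transition_a_b2, branch]; field_simp
    ring

theorem transition_mem_Icc (hx : PositiveProbability x) (u v : Letter) :
    0 ≤ transition x u v ∧ transition x u v ≤ 1 := by
  have hs : ∀ w ∈ Finset.univ.filter (fun w => ¬ SameFactor u w), 0 ≤ x w := fun w _ => (hx.1 w).le
  unfold transition
  split_ifs with h
  · simp
  · exact ⟨div_nonneg (hx.1 v).le (Finset.sum_nonneg hs), div_le_one_of_le₀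
      (Finset.single_le_sum hs (by simpa using h)) (Finset.sum_nonneg hs)⟩

theorem pathWeight_mem_Icc (hx : PositiveProbability x) (u : Letter) (t : List Letter) :
    0 ≤ pathWeight x u t ∧ pathWeight x u t ≤ 1 := by
  induction t generalizing u with
  | nil => simp [pathWeight]
  | cons v t ih =>
    exact ⟨mul_nonneg (transition_mem_Icc hx u v).1 (ih v).1,
      mul_le_one₀ (transition_mem_Icc hx u v).2 (ih v).1 (ih v).2⟩

theorem prefixProb_mem_Icc (hx : PositiveProbability x) (u : Letter) (w t : List Letter) :
    0 ≤ prefixProb x u w t ∧ prefixProb x u w t ≤ 1 := by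
  induction t generalizing w with
  | nil => simp [prefixProb]
  | cons v t ih =>
    cases w with
    | nil => exact pathWeight_mem_Icc hx u _
    | cons s w =>
      simp only [prefixProb]
      split_ifs
      · exact ih w
      · simp

theorem prefixProb_of_length_le (u : Letter) {w t : List Letter} (h : t.length ≤ w.length) :
    prefixProb x u w t = if w.take t.length = t then 1 else 0 := by
  induction t generalizing w with
  | nil => simp [prefixProb]
  | cons v t ih =>
    cases w with
    | nil => simp at h
    | cons s w =>
      have := ih (w := w) (by simpa using h)
      by_cases hs : s = v <;> simp [prefixProb, hs, this]

theorem convex_mem_Icc {a b u v : ℝ} (ha : 0 ≤ a) (hb : 0 ≤ b) (hab : a + b = 1)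
    (hu : 0 ≤ u ∧ u ≤ 1) (hv : 0 ≤ v ∧ v ≤ 1) : 0 ≤ a * u + b * v ∧ a * u + b * v ≤ 1 :=
  ⟨add_nonneg (mul_nonneg ha hu.1) (mul_nonneg hb hv.1), by
    have := mul_le_mul_of_nonneg_left hu.2 ha
    have := mul_le_mul_of_nonneg_left hv.2 hb
    linarith⟩

theorem condValue_mem_Icc (hx : PositiveProbability x) (hA : ∀ l, 0 ≤ TA l ∧ TA l ≤ 1)
    (hB : ∀ l, 0 ≤ TB l ∧ TB l ≤ 1) (l : List Letter) :
    (0 ≤ (condValue x 0 TA TB l).1 ∧ (condValue x 0 TA TB l).1 ≤ 1) ∧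
      (0 ≤ (condValue x 0 TA TB l).2 ∧ (condValue x 0 TA TB l).2 ≤ 1) := by
  have p1 := (branch_pos hx .b).le
  have p2 := (branch_pos hx .b2).le
  have h12 := branch_add_branch hx
  induction l with
  | nil => exact ⟨hA _, hB _⟩
  | cons s l ih =>
    cases s <;> simp only [condValue, sub_zero]
    · exact ⟨ih.2, hB _⟩
    · exact ⟨hA _, convex_mem_Icc p1 p2 h12 (hA _) ih.1⟩
    · exact ⟨hA _, convex_mem_Icc p1 p2 h12 ih.1 (hA _)⟩

theorem cylinderValue_mem_Icc (hx : PositiveProbability x) (t l : List Letter) :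
    0 ≤ cylinderValue x t l ∧ cylinderValue x t l ≤ 1 := by
  have h := condValue_mem_Icc hx (TA := fun l => prefixProb x .b l.reverse t)
    (TB := fun l => prefixProb x .a l.reverse t) (fun _ => prefixProb_mem_Icc hx _ _ _)
    (fun _ => prefixProb_mem_Icc hx _ _ _) l
  have hsum := hx.2
  rw [sum_letter] at hsum
  exact convex_mem_Icc (hx.1 _).le (add_pos (hx.1 _) (hx.1 _)).le (by linarith) h.1 h.2

/-- Disturbing a prefix lying k letters below the top requires y to cancel through those letters. At
every second cancellation y must choose the right one of b, b², which has probability at most ρ. -/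
theorem exists_abs_cylinderValue_sub_le (hx : PositiveProbability x) :
    ∃ ρ : ℝ, 0 ≤ ρ ∧ ρ < 1 ∧ ∀ (t l : List Letter) (k : ℕ), t.length + k ≤ l.length →
      |cylinderValue x t l - if l.reverse.take t.length = t then 1 else 0| ≤ ρ ^ (k / 2) := by
  obtain ⟨ρ, hρ0, hρ1, h1, h2⟩ := exists_branch_le hx
  have p1 := branch_pos hx .b
  have p2 := branch_pos hx .b2
  have h12 := branch_add_branch hx
  refine ⟨ρ, hρ0, hρ1, fun t => ?_⟩
  set TA : List Letter → ℝ := fun l => prefixProb x .b l.reverse t with hTA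
  set TB : List Letter → ℝ := fun l => prefixProb x .a l.reverse t with hTB
  -- The exponents differ because a word starting with b or b² has to make its choice at once, one
  -- starting with a only after its first letter.
  have key : ∀ (l : List Letter) (k : ℕ), t.length + k ≤ l.length →
      |(condValue x 0 TA TB l).1 - if l.reverse.take t.length = t then 1 else 0| ≤ ρ ^ (k / 2) ∧
      |(condValue x 0 TA TB l).2 - if l.reverse.take t.length = t then 1 else 0|
        ≤ ρ ^ ((k + 1) / 2) := by
    intro l
    induction l with
    | nil =>
      intro k hk
      obtain ⟨ht, rfl⟩ : t = [] ∧ k = 0 := by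
        simp at hk; exact hk
      subst ht
      simp [condValue, hTA, hTB, prefixProb]
    | cons s l ih =>
      intro k hk
      have hI := condValue_mem_Icc hx (TA := TA) (TB := TB) (fun _ => prefixProb_mem_Icc hx _ _ _)
        (fun _ => prefixProb_mem_Icc hx _ _ _) (s :: l)
      cases k with
      | zero =>
        simp only [Nat.zero_div, pow_zero, abs_le]
        split_ifs <;> refine ⟨⟨?_, ?_⟩, ?_, ?_⟩ <;> simp <;> linarith [hI.1.1, hI.1.2, hI.2.1, hI.2.2]
      | succ k =>
        have hk' : t.length + k ≤ l.length := by simpa [← add_assoc] using hk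
        have hT : ∀ u v, prefixProb x u (v :: l).reverse t
            = if l.reverse.take t.length = t then 1 else 0 := fun u v => by
          rw [prefixProb_of_length_le u (by simp; omega), List.reverse_cons,
            List.take_append_of_le_length (by simp; omega)]
        have htake : (s :: l).reverse.take t.length = l.reverse.take t.length := by
          rw [List.reverse_cons, List.take_append_of_le_length (by simp; omega)]
        obtain ⟨i1, i2⟩ := ih k hk'
        rw [htake]
        generalize (if l.reverse.take t.length = t then (1 : ℝ) else 0) = τ at *
        have hpow : ρ ^ ((k + 1 + 1) / 2) = ρ * ρ ^ (k / 2) := by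
          rw [show (k + 1 + 1) / 2 = k / 2 + 1 by omega, pow_succ']
        cases s <;> simp only [condValue, sub_zero, hTA, hTB, hT]
        · exact ⟨i2, by simpa using pow_nonneg hρ0 _⟩
        · refine ⟨by simpa using pow_nonneg hρ0 _, ?_⟩
          rw [show branch x .b * τ + branch x .b2 * (condValue x 0 TA TB l).1 - τ
            = branch x .b2 * ((condValue x 0 TA TB l).1 - τ) by linear_combination τ * h12,
            abs_mul, abs_of_pos p2, hpow]
          exact mul_le_mul h2 i1 (abs_nonneg _) hρ0
        · refine ⟨by simpa using pow_nonneg hρ0 _, ?_⟩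
          rw [show branch x .b * (condValue x 0 TA TB l).1 + branch x .b2 * τ - τ
            = branch x .b * ((condValue x 0 TA TB l).1 - τ) by linear_combination τ * h12,
            abs_mul, abs_of_pos p1, hpow]
          exact mul_le_mul h1 i1 (abs_nonneg _) hρ0
  intro l k hk
  obtain ⟨i1, i2⟩ := key l k hk
  have i3 : ρ ^ ((k + 1) / 2) ≤ ρ ^ (k / 2) := pow_le_pow_of_le_one hρ0 hρ1.le (by omega)
  have hsum := hx.2
  rw [sum_letter] at hsum
  have ha := hx.1 .a
  have hβ : 0 < x .b + x .b2 := add_pos (hx.1 _) (hx.1 _)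
  have hval : cylinderValue x t l = x .a * (condValue x 0 TA TB l).1
    + (x .b + x .b2) * (condValue x 0 TA TB l).2 := rfl
  rw [hval]
  generalize (if l.reverse.take t.length = t then (1 : ℝ) else 0) = τ at *
  rw [show x .a * (condValue x 0 TA TB l).1 + (x .b + x .b2) * (condValue x 0 TA TB l).2 - τ
    = x .a * ((condValue x 0 TA TB l).1 - τ)
      + (x .b + x .b2) * ((condValue x 0 TA TB l).2 - τ) by linear_combination τ * hsum]
  refine (abs_add_le _ _).trans ?_
  rw [abs_mul, abs_mul, abs_of_pos ha, abs_of_pos hβ]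
  have m1 := mul_le_mul_of_nonneg_left i1 ha.le
  have m2 := mul_le_mul_of_nonneg_left (i2.trans i3) hβ.le
  calc _ ≤ _ := add_le_add m1 m2
    _ = ρ ^ (k / 2) := by linear_combination ρ ^ (k / 2) * hsum

end Harmonic

/-! ### The random walk -/

theorem walk_zero {Ω : Type*} (ξ : ℕ → Ω → G) (ω : Ω) : walk ξ 0 ω = 1 := by simp [walk]

theorem walk_succ {Ω : Type*} (ξ : ℕ → Ω → G) (n : ℕ) (ω : Ω) :
    walk ξ (n + 1) ω = walk ξ n ω * ξ n ω := by
  simp [walk, List.range_succ]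

theorem lintegral_stepLaw (p q : ℝ) (Ψ : G → ENNReal) :
    ∫⁻ s, Ψ s ∂(stepLaw p q) = ENNReal.ofReal (1 - p - q) * Ψ genA
      + ENNReal.ofReal p * Ψ genB + ENNReal.ofReal q * Ψ (genB ^ 2) := by
  simp [stepLaw, lintegral_add_measure, lintegral_smul_measure]

section Walk

variable {Ω : Type*} [MeasurableSpace Ω] {P : Measure Ω} {ξ : ℕ → Ω → G} {p q : ℝ}

theorem measurable_walk (hξ : IsStepSequence p q P ξ) (n : ℕ) : Measurable (walk ξ n) := by
  induction n with
  | zero => simp only [funext (walk_zero ξ)]; exact measurable_const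
  | succ n ih =>
    simp only [funext (walk_succ ξ n)]
    exact (measurable_of_countable (fun y : G × G => y.1 * y.2)).comp
      (ih.prodMk (hξ.measurable n))

theorem indepFun_walk (hξ : IsStepSequence p q P ξ) (n : ℕ) : IndepFun (walk ξ n) (ξ n) P := by
  have h := hξ.indep.indepFun_finset (Finset.range n) {n} (by simp) hξ.measurable
  -- This exhibits the walk at time n as a function of the first n increments; the default 1 is
  -- never reached.
  let φ : (Finset.range n → G) → G := fun f =>
    ((List.range n).map (fun i => if hi : i ∈ Finset.range n then f ⟨i, hi⟩ else 1)).prod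
  let ψ : (({n} : Finset ℕ) → G) → G := fun f => f ⟨n, by simp⟩
  have h' := h.comp (φ := φ) (ψ := ψ) (measurable_of_countable _) (measurable_of_countable _)
  have e : walk ξ n = φ ∘ fun ω (i : Finset.range n) => ξ i ω := by
    funext ω
    simp only [walk, Function.comp, φ]
    congr 1
    refine List.map_congr_left fun i hi => ?_
    rw [dif_pos (by simpa using hi)]
  rw [e]
  exact h'

/-- The Markov property in integrated form: the next increment is independent of the present
position, so Fubini applies. -/
theorem lintegral_walk_succ [IsProbabilityMeasure P] (hξ : IsStepSequence p q P ξ) (n : ℕ)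
    (Ψ : G → ENNReal) :
    ∫⁻ ω, Ψ (walk ξ (n + 1) ω) ∂P = ∫⁻ ω, (ENNReal.ofReal (1 - p - q) * Ψ (walk ξ n ω * genA)
      + ENNReal.ofReal p * Ψ (walk ξ n ω * genB)
      + ENNReal.ofReal q * Ψ (walk ξ n ω * genB ^ 2)) ∂P := by
  have hX := measurable_walk hξ n
  have hmap := (indepFun_iff_map_prod_eq_prod_map_map hX.aemeasurable
    (hξ.measurable n).aemeasurable).1 (indepFun_walk hξ n)
  have : IsProbabilityMeasure (P.map (ξ n)) :=
    Measure.isProbabilityMeasure_map (hξ.measurable n).aemeasurable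
  calc ∫⁻ ω, Ψ (walk ξ (n + 1) ω) ∂P
      = ∫⁻ z, Ψ (z.1 * z.2) ∂(P.map fun ω => (walk ξ n ω, ξ n ω)) := by
        rw [lintegral_map (measurable_of_countable _) (hX.prodMk (hξ.measurable n))]
        simp only [walk_succ]
    _ = ∫⁻ g, ∫⁻ s, Ψ (g * s) ∂(P.map (ξ n)) ∂(P.map (walk ξ n)) := by
        rw [hmap, lintegral_prod _ (measurable_of_countable _).aemeasurable]
    _ = _ := by
        rw [lintegral_map (measurable_of_countable _) hX, hξ.law]
        simp only [lintegral_stepLaw]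

theorem ae_step_eq_toG (hξ : IsStepSequence p q P ξ) :
    ∀ᵐ ω ∂P, ∀ n, ∃ s : Letter, ξ n ω = s.toG := by
  rw [ae_all_iff]
  intro n
  have h : ∀ᵐ g ∂(P.map (ξ n)), ∃ s : Letter, g = s.toG := by
    rw [hξ.law, stepLaw, ae_add_measure_iff, ae_add_measure_iff]
    refine ⟨⟨?_, ?_⟩, ?_⟩ <;> refine Measure.ae_smul_measure ?_ _ <;>
      rw [ae_dirac_iff (MeasurableSet.of_discrete)]
    · exact ⟨.a, rfl⟩
    · exact ⟨.b, rfl⟩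
    · exact ⟨.b2, rfl⟩
  exact ae_of_ae_map (hξ.measurable n).aemeasurable h

theorem reduced_stack (g : G) : Reduced (stack g) := reduced_reverse (reduced_normalForm g)

theorem stack_mul_genA (g : G) : stack (g * genA) = push .a (stack g) := stack_mul_toG g .a

theorem stack_mul_genB (g : G) : stack (g * genB) = push .b (stack g) := stack_mul_toG g .b

theorem stack_mul_genB_sq (g : G) : stack (g * genB ^ 2) = push .b2 (stack g) :=
  stack_mul_toG g .b2

theorem ofReal_average (hA : Admissible p q) {u v w : ℝ} (hu : 0 ≤ u) (hv : 0 ≤ v) (hw : 0 ≤ w) :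
    ENNReal.ofReal (1 - p - q) * ENNReal.ofReal u + ENNReal.ofReal p * ENNReal.ofReal v
      + ENNReal.ofReal q * ENNReal.ofReal w
      = ENNReal.ofReal ((1 - p - q) * u + p * v + q * w) := by
  obtain ⟨hp, hq, h0, h1⟩ := hA
  have hr : 0 ≤ 1 - p - q := by linarith
  rw [ENNReal.ofReal_add (by positivity) (by positivity),
    ENNReal.ofReal_add (by positivity) (by positivity), ENNReal.ofReal_mul hr,
    ENNReal.ofReal_mul hp, ENNReal.ofReal_mul hq]

/-- Harmonicity makes the expectation constant in n, so it keeps its value at the identity. -/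
theorem lintegral_cylinderValue [IsProbabilityMeasure P] (hA : Admissible p q)
    (hξ : IsStepSequence p q P ξ) (t : List Letter) (n : ℕ) :
    ∫⁻ ω, ENNReal.ofReal (cylinderValue (trafficSolution p q) t (stack (walk ξ n ω))) ∂P
      = ENNReal.ofReal (cylinderWeight (trafficSolution p q) t) := by
  have hx := trafficSolution_positiveProbability hA
  induction n with
  | zero => simp [walk_zero, stack_one, cylinderValue_nil hx]
  | succ n ih =>
    rw [← ih, lintegral_walk_succ hξ n
      (fun g => ENNReal.ofReal (cylinderValue (trafficSolution p q) t (stack g)))]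
    refine lintegral_congr fun ω => ?_
    rw [ofReal_average hA (cylinderValue_mem_Icc hx _ _).1 (cylinderValue_mem_Icc hx _ _).1
      (cylinderValue_mem_Icc hx _ _).1, stack_mul_genA, stack_mul_genB, stack_mul_genB_sq,
      cylinderValue_harmonic hx (trafficSolution_trafficEquations hA) t (reduced_stack _)]

/-! #### Drift -/

theorem exists_abs_lengthValue_push_sub_le {x : Letter → ℝ} (hx : PositiveProbability x) :
    ∃ B, 0 ≤ B ∧ ∀ s l, |lengthValue x (push s l) - lengthValue x l| ≤ B := by
  obtain ⟨K, hK⟩ := abs_lengthValue_sub_length_le hx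
  have hK0 : 0 ≤ K := (abs_nonneg _).trans (hK [])
  refine ⟨2 * K + 1, by positivity, fun s l => ?_⟩
  have h1 := abs_le.1 (hK (push s l))
  have h2 := abs_le.1 (hK l)
  have h3 : ((push s l).length : ℝ) ≤ l.length + 1 := by exact_mod_cast length_push_le s l
  have h4 : (l.length : ℝ) ≤ (push s l).length + 1 := by exact_mod_cast le_length_push s l
  rw [abs_le]
  constructor <;> linarith

/-- One step of the martingale variance estimate: the increment is centred, so the cross term
vanishes and only its bounded square is added. -/
theorem average_sq_le (hA : Admissible p q) {y γ B u v w z : ℝ}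
    (hu : |u - z| ≤ B) (hv : |v - z| ≤ B) (hw : |w - z| ≤ B) (hγ : |γ| ≤ B)
    (h : (1 - p - q) * u + p * v + q * w = z + γ) :
    (1 - p - q) * (u - (y + γ)) ^ 2 + p * (v - (y + γ)) ^ 2 + q * (w - (y + γ)) ^ 2
      ≤ (z - y) ^ 2 + (2 * B) ^ 2 := by
  obtain ⟨hp, hq, h0, h1⟩ := hA
  have aux : ∀ u, |u - z| ≤ B → (u - z - γ) ^ 2 ≤ (2 * B) ^ 2 := fun u hu => by
    rw [sq_le_sq, abs_of_nonneg (show 0 ≤ 2 * B by linarith [abs_nonneg γ])]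
    exact (abs_sub _ _).trans (by linarith)
  have m1 := mul_le_mul_of_nonneg_left (aux u hu) (show 0 ≤ 1 - p - q by linarith)
  have m2 := mul_le_mul_of_nonneg_left (aux v hv) hp
  have m3 := mul_le_mul_of_nonneg_left (aux w hw) hq
  have e : (1 - p - q) * (u - (y + γ)) ^ 2 + p * (v - (y + γ)) ^ 2 + q * (w - (y + γ)) ^ 2
      = (z - y) ^ 2 + ((1 - p - q) * (u - z - γ) ^ 2 + p * (v - z - γ) ^ 2
        + q * (w - z - γ) ^ 2) := by
    linear_combination 2 * (z - y) * h
  rw [e]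
  linarith

theorem exists_lintegral_sq_le [IsProbabilityMeasure P] (hA : Admissible p q)
    (hξ : IsStepSequence p q P ξ) :
    ∃ C, 0 ≤ C ∧ ∀ n : ℕ, ∫⁻ ω, ENNReal.ofReal
      ((lengthValue (trafficSolution p q) (stack (walk ξ n ω))
        - n * driftFormula (1 - p - q) p q) ^ 2) ∂P ≤ ENNReal.ofReal (C * (n + 1)) := by
  have hx := trafficSolution_positiveProbability hA
  have ht := trafficSolution_trafficEquations hA
  obtain ⟨B, hB0, hB⟩ := exists_abs_lengthValue_push_sub_le hx
  set γ := driftFormula (1 - p - q) p q with hγ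
  set f := lengthValue (trafficSolution p q) with hf
  set B' := max B |γ|
  -- The first summand pays for time 0, the second for the variance of each step.
  set C := f [] ^ 2 + (2 * B') ^ 2 with hC
  have hC0 : 0 ≤ C := by positivity
  refine ⟨C, hC0, fun n => ?_⟩
  induction n with
  | zero =>
    simp only [walk_zero, stack_one, Nat.cast_zero, zero_mul, sub_zero, lintegral_const,
      measure_univ, mul_one, zero_add]
    exact ENNReal.ofReal_le_ofReal (by rw [hC]; nlinarith [sq_nonneg (2 * B')])
  | succ n ih =>
    rw [lintegral_walk_succ hξ n
      (fun g => ENNReal.ofReal ((f (stack g) - (n + 1 : ℕ) * γ) ^ 2))]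
    calc _ ≤ ∫⁻ ω, (ENNReal.ofReal ((f (stack (walk ξ n ω)) - n * γ) ^ 2)
            + ENNReal.ofReal C) ∂P := by
          refine lintegral_mono fun ω => ?_
          rw [ofReal_average hA (sq_nonneg _) (sq_nonneg _) (sq_nonneg _), stack_mul_genA,
            stack_mul_genB, stack_mul_genB_sq, ← ENNReal.ofReal_add (sq_nonneg _) hC0]
          refine ENNReal.ofReal_le_ofReal ?_
          have hh := lengthValue_harmonic hx ht (reduced_stack (walk ξ n ω))
          rw [← driftFormula_eq hA] at hh
          have := average_sq_le hA (y := n * γ) ((hB .a (stack (walk ξ n ω))).trans (le_max_left B |γ|))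
            ((hB .b _).trans (le_max_left _ _)) ((hB .b2 _).trans (le_max_left _ _))
            (le_max_right _ _) hh
          rw [show ((n + 1 : ℕ) : ℝ) * γ = n * γ + γ by push_cast; ring]
          exact this.trans (by rw [hC]; nlinarith [sq_nonneg (f [])])
      _ ≤ ENNReal.ofReal (C * (n + 1)) + ENNReal.ofReal C := by
          rw [lintegral_add_right _ measurable_const, lintegral_const, measure_univ, mul_one]
          gcongr
      _ = _ := by
          rw [← ENNReal.ofReal_add (by positivity) hC0]; congr 1; push_cast; ring

/-- A sequence with bounded increments which is sublinear along the squares is sublinear. -/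
theorem tendsto_div_of_tendsto_sq {u : ℕ → ℝ} {B : ℝ} (hB : ∀ n, |u (n + 1) - u n| ≤ B)
    (h : Tendsto (fun k : ℕ => u (k ^ 2) / (k : ℝ) ^ 2) atTop (𝓝 0)) :
    Tendsto (fun n : ℕ => u n / n) atTop (𝓝 0) := by
  have hB0 : 0 ≤ B := (abs_nonneg _).trans (hB 0)
  have hinc : ∀ m k, |u (m + k) - u m| ≤ k * B := by
    intro m k
    induction k with
    | zero => simp
    | succ k ih =>
      have e : u (m + (k + 1)) - u m = (u (m + k + 1) - u (m + k)) + (u (m + k) - u m) := by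
        rw [← add_assoc]; ring
      rw [e]
      refine (abs_add_le _ _).trans ?_
      push_cast
      linarith [hB (m + k)]
  have hsqrt : Tendsto Nat.sqrt atTop atTop :=
    tendsto_atTop_atTop.2 fun b => ⟨b * b, fun n hn => Nat.le_sqrt.2 hn⟩
  have hlim : Tendsto (fun k : ℕ => |u (k ^ 2) / (k : ℝ) ^ 2| + 2 * B / k) atTop (𝓝 0) := by
    have := h.abs.add (tendsto_const_div_atTop_nhds_zero_nat (2 * B))
    simpa using this
  refine squeeze_zero_norm' ?_ (hlim.comp hsqrt)
  filter_upwards [eventually_ge_atTop 1] with n hn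
  obtain ⟨k, hk⟩ : ∃ k, k = Nat.sqrt n := ⟨_, rfl⟩
  have hk1 : 1 ≤ k := hk ▸ Nat.le_sqrt.2 (by simpa using hn)
  have hkn : k ^ 2 ≤ n := hk ▸ Nat.sqrt_le' n
  simp only [Function.comp]
  rw [← hk]
  obtain ⟨j, rfl⟩ := Nat.exists_eq_add_of_le hkn
  -- Consecutive squares k² and (k+1)² leave a gap of order k, negligible against k².
  have hj : j ≤ 2 * k := by
    have := Nat.sqrt_le_add (k ^ 2 + j)
    rw [← hk] at this
    nlinarith
  have hk0 : (0 : ℝ) < k := by exact_mod_cast hk1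
  have hj' : (j : ℝ) ≤ 2 * k := by exact_mod_cast hj
  have h1 : |u (k ^ 2 + j)| ≤ |u (k ^ 2)| + 2 * k * B := by
    have h2 := hinc (k ^ 2) j
    have h3 := abs_add_le (u (k ^ 2 + j) - u (k ^ 2)) (u (k ^ 2))
    rw [sub_add_cancel] at h3
    have h4 := mul_le_mul_of_nonneg_right hj' hB0
    linarith
  have hcast : (k : ℝ) ^ 2 ≤ ((k ^ 2 + j : ℕ) : ℝ) := by push_cast; linarith [j.cast_nonneg (α := ℝ)]
  rw [Real.norm_eq_abs, abs_div, Nat.abs_cast]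
  calc |u (k ^ 2 + j)| / ((k ^ 2 + j : ℕ) : ℝ) ≤ (|u (k ^ 2)| + 2 * k * B) / (k : ℝ) ^ 2 := by
        gcongr
    _ = |u (k ^ 2) / (k : ℝ) ^ 2| + 2 * B / k := by
        rw [abs_div, abs_of_pos (show 0 < (k : ℝ) ^ 2 by positivity)]
        field_simp

/-- At time k² the normalised second moment is at most C(k²+1)/k⁴ ≤ 2C/k², which is summable. The
sum of the squares is then almost surely finite, so its terms tend to 0. -/
theorem ae_tendsto_lengthValue_sq [IsProbabilityMeasure P] (hA : Admissible p q)
    (hξ : IsStepSequence p q P ξ) :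
    ∀ᵐ ω ∂P, Tendsto (fun k : ℕ => (lengthValue (trafficSolution p q) (stack (walk ξ (k ^ 2) ω))
      - (k ^ 2 : ℕ) * driftFormula (1 - p - q) p q) / (k : ℝ) ^ 2) atTop (𝓝 0) := by
  obtain ⟨C, hC0, hC⟩ := exists_lintegral_sq_le hA hξ
  set M : ℕ → Ω → ℝ := fun k ω => (lengthValue (trafficSolution p q) (stack (walk ξ (k ^ 2) ω))
      - (k ^ 2 : ℕ) * driftFormula (1 - p - q) p q) with hM
  have hmeas : ∀ k, Measurable fun ω => ENNReal.ofReal ((M k ω / (k : ℝ) ^ 2) ^ 2) := fun k =>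
    (measurable_of_countable (fun g : G =>
      ENNReal.ofReal (((lengthValue (trafficSolution p q) (stack g)
        - (k ^ 2 : ℕ) * driftFormula (1 - p - q) p q) / (k : ℝ) ^ 2) ^ 2))).comp
      (measurable_walk hξ (k ^ 2))
  have hbound : ∀ k : ℕ, ∫⁻ ω, ENNReal.ofReal ((M k ω / (k : ℝ) ^ 2) ^ 2) ∂P
      ≤ ENNReal.ofReal (2 * C * (1 / (k : ℝ) ^ 2)) := by
    intro k
    rcases Nat.eq_zero_or_pos k with rfl | hk
    · simp
    · have hk0 : (1 : ℝ) ≤ k := by exact_mod_cast hk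
      have hk1 : (0 : ℝ) < k := by linarith
      have e : ∀ ω, ENNReal.ofReal ((M k ω / (k : ℝ) ^ 2) ^ 2)
          = ENNReal.ofReal (1 / (k : ℝ) ^ 4) * ENNReal.ofReal (M k ω ^ 2) := fun ω => by
        rw [← ENNReal.ofReal_mul (by positivity)]; congr 1; field_simp
      simp only [e]
      rw [lintegral_const_mul' _ _ ENNReal.ofReal_ne_top]
      refine (mul_le_mul_right (hC (k ^ 2)) _).trans ?_
      rw [← ENNReal.ofReal_mul (by positivity)]
      refine ENNReal.ofReal_le_ofReal ?_
      push_cast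
      rw [one_div, inv_mul_le_iff₀ (by positivity)]
      have : (k : ℝ) ^ 4 * (2 * C * (1 / (k : ℝ) ^ 2)) = 2 * C * (k : ℝ) ^ 2 := by field_simp
      rw [this]
      have : 1 ≤ (k : ℝ) ^ 2 := one_le_pow₀ hk0
      nlinarith
  have hsum : ∫⁻ ω, ∑' k : ℕ, ENNReal.ofReal ((M k ω / (k : ℝ) ^ 2) ^ 2) ∂P ≠ ⊤ := by
    rw [lintegral_tsum fun k => (hmeas k).aemeasurable]
    refine ne_top_of_le_ne_top ?_ (ENNReal.tsum_le_tsum hbound)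
    exact ((Real.summable_one_div_nat_pow.2 one_lt_two).mul_left _).tsum_ofReal_ne_top
  filter_upwards [ae_lt_top (Measurable.tsum hmeas) hsum] with ω hω
  have h1 := ENNReal.tendsto_atTop_zero_of_tsum_ne_top hω.ne
  have h2 := (ENNReal.tendsto_toReal ENNReal.zero_ne_top).comp h1
  simp only [Function.comp_def, ENNReal.toReal_ofReal (sq_nonneg _), ENNReal.toReal_zero] at h2
  have h3 := (Real.continuous_sqrt.tendsto 0).comp h2
  simp only [Function.comp_def, Real.sqrt_sq_eq_abs, Real.sqrt_zero] at h3
  exact (tendsto_zero_iff_abs_tendsto_zero _).2 h3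

theorem hasDrift_walk [IsProbabilityMeasure P] (hA : Admissible p q)
    (hξ : IsStepSequence p q P ξ) :
    HasDrift P (walk ξ) (driftFormula (1 - p - q) p q) := by
  have hx := trafficSolution_positiveProbability hA
  obtain ⟨K, hK⟩ := abs_lengthValue_sub_length_le hx
  obtain ⟨B, hB0, hB⟩ := exists_abs_lengthValue_push_sub_le hx
  filter_upwards [ae_step_eq_toG hξ, ae_tendsto_lengthValue_sq hA hξ] with ω hs hsq
  set γ := driftFormula (1 - p - q) p q
  set f := lengthValue (trafficSolution p q)
  have h1 : Tendsto (fun n : ℕ => (f (stack (walk ξ n ω)) - n * γ) / n) atTop (𝓝 0) := by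
    refine tendsto_div_of_tendsto_sq (B := B + |γ|) (fun n => ?_) hsq
    obtain ⟨s, hs⟩ := hs n
    rw [walk_succ, hs, stack_mul_toG]
    have e : f (push s (stack (walk ξ n ω))) - (n + 1 : ℕ) * γ - (f (stack (walk ξ n ω)) - n * γ)
        = (f (push s (stack (walk ξ n ω))) - f (stack (walk ξ n ω))) - γ := by push_cast; ring
    rw [e]
    exact (abs_sub _ _).trans (by linarith [hB s (stack (walk ξ n ω))])
  have h2 : Tendsto (fun n : ℕ => ((wordLength (walk ξ n ω) : ℝ) - f (stack (walk ξ n ω))) / n)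
      atTop (𝓝 0) := by
    refine squeeze_zero_norm (fun n => ?_) (tendsto_const_div_atTop_nhds_zero_nat K)
    rw [norm_div, Real.norm_eq_abs, Real.norm_natCast, abs_sub_comm, ← length_stack]
    exact div_le_div_of_nonneg_right (hK _) n.cast_nonneg
  have h3 := (h1.add h2).add_const γ
  rw [zero_add, zero_add] at h3
  refine h3.congr' ?_
  filter_upwards [eventually_ge_atTop 1] with n hn
  have : (n : ℝ) ≠ 0 := by positivity
  field_simp
  ring

theorem ae_tendsto_wordLength [IsProbabilityMeasure P] (hA : Admissible p q)
    (hξ : IsStepSequence p q P ξ) :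
    ∀ᵐ ω ∂P, Tendsto (fun n => wordLength (walk ξ n ω)) atTop atTop := by
  filter_upwards [hasDrift_walk hA hξ] with ω hω
  have h1 := hω.pos_mul_atTop (driftFormula_pos hA) tendsto_natCast_atTop_atTop
  refine tendsto_natCast_atTop_iff.1 (h1.congr' ?_)
  filter_upwards [eventually_ge_atTop 1] with n hn
  have : (n : ℝ) ≠ 0 := by positivity
  field_simp

end Walk

/-! ### Harmonic measure -/

/-- The limit of the normal forms, letter by letter, where it exists. -/
def limitWord (g : ℕ → G) (k : ℕ) : Letter :=
  open Classical in
  if ∀ᶠ n in atTop, (normalForm (g n))[k]? = some .b then .b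
  else if ∀ᶠ n in atTop, (normalForm (g n))[k]? = some .b2 then .b2
  else .a

theorem convergesToWord_iff {g : ℕ → G} {w : ℕ → Letter} :
    ConvergesToWord g w ↔ ∀ k, ∀ᶠ n in atTop, (normalForm (g n))[k]? = some (w k) := by
  simp only [ConvergesToWord, isNormalForm_iff, exists_eq_left]

theorem ConvergesToWord.eq_limitWord {g : ℕ → G} {w : ℕ → Letter} (h : ConvergesToWord g w) :
    w = limitWord g := by
  rw [convergesToWord_iff] at h
  have hne : ∀ k v, w k ≠ v → ¬ ∀ᶠ n in atTop, (normalForm (g n))[k]? = some v := by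
    intro k v hv h'
    obtain ⟨n, h1, h2⟩ := ((h k).and h').exists
    exact hv (Option.some.inj (h1.symm.trans h2))
  funext k
  unfold limitWord
  rcases hk : w k
  · rw [if_neg (hne k _ (by simp [hk])), if_neg (hne k _ (by simp [hk]))]
  · rw [if_pos (hk ▸ h k)]
  · rw [if_neg (hne k _ (by simp [hk])), if_pos (hk ▸ h k)]

/-- Once the length stays above k+1, later steps cannot alter the first k+1 letters. -/
theorem exists_convergesToWord {g : ℕ → G} (hstep : ∀ n, ∃ s : Letter, g (n + 1) = g n * s.toG)
    (hlen : Tendsto (fun n => wordLength (g n)) atTop atTop) : ∃ w, ConvergesToWord g w := by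
  have hk : ∀ k : ℕ, ∃ v, ∀ᶠ n in atTop, (normalForm (g n))[k]? = some v := by
    intro k
    obtain ⟨N, hN⟩ := eventually_atTop.1 (hlen.eventually_gt_atTop (k + 1))
    have hlt : ∀ n ≥ N, k + 1 < (stack (g n)).length := fun n hn => by
      rw [length_stack]; exact hN n hn
    have hconst : ∀ n ≥ N, (normalForm (g n)).take (k + 1) = (normalForm (g N)).take (k + 1) := by
      intro n hn
      induction n, hn using Nat.le_induction with
      | base => rfl
      | succ n hn ih =>
        obtain ⟨s, hs⟩ := hstep n
        have := take_reverse_push s (hlt n hn)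
        rw [← stack_mul_toG, ← hs] at this
        simpa [stack, ih] using this
    have hkN : k < (normalForm (g N)).length := by
      have := hlt N le_rfl
      rw [stack, List.length_reverse] at this
      omega
    refine ⟨(normalForm (g N))[k], eventually_atTop.2 ⟨N, fun n hn => ?_⟩⟩
    rw [← List.getElem?_take_of_lt (Nat.lt_succ_self k), hconst n hn,
      List.getElem?_take_of_lt (Nat.lt_succ_self k), List.getElem?_eq_getElem hkN]
  choose w hw using hk
  exact ⟨w, convergesToWord_iff.2 hw⟩

theorem measurableSet_cylinder (t : List Letter) : MeasurableSet (cylinder t) := by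
  have : cylinder t = ⋂ i, ⋂ h : i < t.length, (fun w : ℕ → Letter => w i) ⁻¹' {t[i]} := by
    ext w; simp [cylinder]
  rw [this]
  exact MeasurableSet.iInter fun i => MeasurableSet.iInter fun h =>
    measurable_pi_apply i (MeasurableSet.of_discrete)

theorem measurable_shift : Measurable shift :=
  measurable_pi_lambda _ fun n => measurable_pi_apply (n + 1)

/-- A Markovian multiplicative measure with `x(a) < 1/2` is not shift invariant. -/
theorem IsMarkovMultiplicative.map_shift_ne {x : Letter → ℝ} (hx : PositiveProbability x)
    (ha : x .a < 1 / 2) {ν : Measure (ℕ → Letter)} (h : IsMarkovMultiplicative x ν) :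
    ν.map shift ≠ ν := by
  intro heq
  have hsum := hx.2
  rw [sum_letter] at hsum
  have h1 : ν (cylinder [.a]) = ENNReal.ofReal (x .a) := by
    rw [h]; simp [cylinderWeight, pathWeight]
  have h2 : ν (cylinder [.b, .a]) = ENNReal.ofReal (x .b) := by
    rw [h]; simp [cylinderWeight, pathWeight, transition_b_a hx]
  have h3 : ν (cylinder [.b2, .a]) = ENNReal.ofReal (x .b2) := by
    rw [h, cylinderWeight, pathWeight_b2]; simp [pathWeight, transition_b_a hx]
  have hdisj : Disjoint (cylinder [.b, .a]) (cylinder [.b2, .a]) := by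
    rw [Set.disjoint_left]
    intro w hw hw'
    have e1 := hw 0 (by simp)
    have e2 := hw' 0 (by simp)
    simp [e1] at e2
  -- The letters b and b² are followed by a almost surely, so after a shift the mass of the words
  -- starting with a would be at least x(b)+x(b²) = 1-x(a) > x(a).
  have hsub : cylinder [.b, .a] ∪ cylinder [.b2, .a] ⊆ shift ⁻¹' cylinder [.a] := by
    rintro w (hw | hw) i hi
    · obtain rfl : i = 0 := by simpa using hi
      exact hw 1 (by simp)
    · obtain rfl : i = 0 := by simpa using hi
      exact hw 1 (by simp)
  have h4 := measure_mono (μ := ν) hsub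
  rw [measure_union hdisj (measurableSet_cylinder _), h2, h3,
    ← Measure.map_apply measurable_shift (measurableSet_cylinder _), heq, h1,
    ← ENNReal.ofReal_add (hx.1 _).le (hx.1 _).le, ENNReal.ofReal_le_ofReal_iff (hx.1 _).le] at h4
  linarith

section Walk

variable {Ω : Type*} [MeasurableSpace Ω] {P : Measure Ω} {ξ : ℕ → Ω → G} {p q : ℝ}

theorem measurable_limitWord (hξ : IsStepSequence p q P ξ) :
    Measurable fun ω => limitWord fun n => walk ξ n ω := by
  have hset : ∀ (k : ℕ) (v : Letter), MeasurableSet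
      {ω | ∀ᶠ n in atTop, (normalForm (walk ξ n ω))[k]? = some v} := by
    intro k v
    simp only [eventually_atTop, Set.ofPred_exists, Set.ofPred_forall]
    exact MeasurableSet.iUnion fun N => MeasurableSet.iInter fun n => MeasurableSet.iInter fun _ =>
      measurable_walk hξ n (MeasurableSet.of_discrete (s := {g | (normalForm g)[k]? = some v}))
  refine measurable_pi_lambda _ fun k => ?_
  exact Measurable.ite (hset k .b) measurable_const
    (Measurable.ite (hset k .b2) measurable_const measurable_const)

theorem ae_convergesToWord [IsProbabilityMeasure P] (hA : Admissible p q)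
    (hξ : IsStepSequence p q P ξ) :
    ∀ᵐ ω ∂P, ConvergesToWord (fun n => walk ξ n ω) (limitWord fun n => walk ξ n ω) := by
  filter_upwards [ae_step_eq_toG hξ, ae_tendsto_wordLength hA hξ] with ω hs hlen
  obtain ⟨w, hw⟩ := exists_convergesToWord (g := fun n => walk ξ n ω)
    (fun n => (hs n).imp fun s h => by rw [walk_succ, h]) hlen
  exact hw.eq_limitWord ▸ hw

/-- A limit word is determined by the sequence, so any two choices agree almost surely and have the
same law. -/
theorem isHarmonicMeasure_iff [IsProbabilityMeasure P] (hA : Admissible p q)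
    (hξ : IsStepSequence p q P ξ) (ν : Measure (ℕ → Letter)) :
    IsHarmonicMeasure P (walk ξ) ν ↔ ν = P.map fun ω => limitWord fun n => walk ξ n ω := by
  constructor
  · rintro ⟨X, -, hconv, rfl⟩
    exact Measure.map_congr (hconv.mono fun ω h => h.eq_limitWord)
  · rintro rfl
    exact ⟨_, measurable_limitWord hξ, ae_convergesToWord hA hξ, rfl⟩

theorem tendsto_cylinderValue {x : Letter → ℝ} (hx : PositiveProbability x) {g : ℕ → G}
    {w : ℕ → Letter} (hw : ConvergesToWord g w)
    (hlen : Tendsto (fun n => wordLength (g n)) atTop atTop) (t : List Letter) :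
    Tendsto (fun n => ENNReal.ofReal (cylinderValue x t (stack (g n)))) atTop
      (𝓝 ((cylinder t).indicator 1 w)) := by
  obtain ⟨ρ, hρ0, hρ1, hρ⟩ := exists_abs_cylinderValue_sub_le hx
  rw [convergesToWord_iff] at hw
  have hpre : ∀ᶠ n in atTop, ∀ i ∈ Finset.range t.length, (normalForm (g n))[i]? = some (w i) :=
    (Finset.eventually_all _).2 fun i _ => hw i
  have hlim : Tendsto (fun n => cylinderValue x t (stack (g n))) atTop
      (𝓝 ((cylinder t).indicator 1 w)) := by
    have hdiv : Tendsto (fun n => (wordLength (g n) - t.length) / 2) atTop atTop :=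
      (Nat.tendsto_div_const_atTop two_ne_zero).comp ((tendsto_sub_atTop_nat _).comp hlen)
    rw [tendsto_iff_norm_sub_tendsto_zero]
    refine squeeze_zero' (Eventually.of_forall fun _ => norm_nonneg _) ?_
      ((tendsto_pow_atTop_nhds_zero_of_lt_one hρ0 hρ1).comp hdiv)
    filter_upwards [hpre, hlen.eventually_ge_atTop t.length] with n h1 h2
    have h3 := hρ t (stack (g n)) (wordLength (g n) - t.length) (by rw [length_stack]; omega)
    have hiff : (stack (g n)).reverse.take t.length = t ↔ w ∈ cylinder t := by
      rw [stack, List.reverse_reverse]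
      constructor
      · intro h i hi
        have h4 := h1 i (Finset.mem_range.2 hi)
        rw [← List.getElem?_take_of_lt hi, h, List.getElem?_eq_getElem hi] at h4
        exact (Option.some.inj h4).symm
      · intro h
        apply List.ext_getElem?
        intro i
        by_cases hi : i < t.length
        · rw [List.getElem?_take_of_lt hi, h1 i (Finset.mem_range.2 hi), h i hi,
            List.getElem?_eq_getElem hi]
        · rw [List.getElem?_eq_none (by simp; omega), List.getElem?_eq_none (by omega)]
    have hind : (cylinder t).indicator (1 : (ℕ → Letter) → ℝ) w
        = if (stack (g n)).reverse.take t.length = t then 1 else 0 := by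
      by_cases hm : w ∈ cylinder t
      · rw [Set.indicator_of_mem hm, if_pos (hiff.2 hm)]; rfl
      · rw [Set.indicator_of_notMem hm, if_neg (mt hiff.1 hm)]
    rw [Real.norm_eq_abs, hind]
    exact h3
  have h4 := ENNReal.tendsto_ofReal hlim
  by_cases hm : w ∈ cylinder t
  · simpa [Set.indicator_of_mem hm] using h4
  · simpa [Set.indicator_of_notMem hm] using h4

/-- The integrals of the bounded harmonic functions are constant in n while the integrands tend to
the indicator of the cylinder at the limit word; dominated convergence equates the two. -/
theorem isMarkovMultiplicative_map_limitWord [IsProbabilityMeasure P] (hA : Admissible p q)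
    (hξ : IsStepSequence p q P ξ) :
    IsMarkovMultiplicative (trafficSolution p q)
      (P.map fun ω => limitWord fun n => walk ξ n ω) := by
  intro t
  have hx := trafficSolution_positiveProbability hA
  have hlim := tendsto_lintegral_of_dominated_convergence (μ := P) (bound := fun _ => 1)
    (F := fun n ω => ENNReal.ofReal (cylinderValue (trafficSolution p q) t (stack (walk ξ n ω))))
    (f := fun ω => (cylinder t).indicator 1 (limitWord fun n => walk ξ n ω))
    (fun n => (measurable_of_countable (fun g : G => ENNReal.ofReal
      (cylinderValue (trafficSolution p q) t (stack g)))).comp (measurable_walk hξ n))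
    (fun n => Eventually.of_forall fun ω =>
      ENNReal.ofReal_le_one.2 (cylinderValue_mem_Icc hx t _).2)
    (by simp)
    (by
      filter_upwards [ae_convergesToWord hA hξ, ae_tendsto_wordLength hA hξ] with ω h1 h2
      exact tendsto_cylinderValue hx h1 h2 t)
  simp only [lintegral_cylinderValue hA hξ t] at hlim
  rw [tendsto_nhds_unique tendsto_const_nhds hlim,
    ← lintegral_map (measurable_one.indicator (measurableSet_cylinder t)) (measurable_limitWord hξ),
    lintegral_indicator_one (measurableSet_cylinder t)]

end Walk

end ModularWalk

end

theorem mainTheorem6 :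
    -- explicit solution of the Traffic Equations
    (∀ p q : ℝ, ModularWalk.Admissible p q → ∀ x : ModularWalk.Letter → ℝ,
      (ModularWalk.PositiveProbability x ∧ ModularWalk.TrafficEquations p q x) ↔
        x = ModularWalk.trafficSolution p q) ∧
    -- drift and harmonic measure of the walk
    (∀ p q : ℝ, ModularWalk.Admissible p q →
      ∀ (Ω : Type*) [MeasurableSpace Ω] (P : Measure Ω) [IsProbabilityMeasure P]
        (ξ : ℕ → Ω → ModularWalk.G), ModularWalk.IsStepSequence p q P ξ →
        ModularWalk.HasDrift P (ModularWalk.walk ξ)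
          (ModularWalk.driftFormula (1 - p - q) p q) ∧
        ∃ ν : Measure (ℕ → ModularWalk.Letter),
          (∀ ν', ModularWalk.IsHarmonicMeasure P (ModularWalk.walk ξ) ν' ↔ ν' = ν) ∧
          ModularWalk.IsMarkovMultiplicative (ModularWalk.trafficSolution p q) ν ∧
          ν.map ModularWalk.shift ≠ ν) ∧
    -- maximisation of the drift
    (∃ z₀ : ℝ, (0.490275 < z₀ ∧ z₀ < 0.4902755) ∧
      (∀ z : ℝ, 0.490275 < z → z < 0.4902755 →
        (z ^ 6 + 12 * z ^ 4 - 4 * z ^ 3 + 47 * z ^ 2 - 48 * z + 12 = 0 ↔ z = z₀)) ∧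
      (∀ p q : ℝ, ModularWalk.Admissible p q →
        ModularWalk.driftFormula (1 - p - q) p q ≤ ModularWalk.driftFormula z₀ (1 - z₀) 0 ∧
        (ModularWalk.driftFormula (1 - p - q) p q = ModularWalk.driftFormula z₀ (1 - z₀) 0 ↔
          (p = 1 - z₀ ∧ q = 0) ∨ (p = 0 ∧ q = 1 - z₀))) ∧
      |ModularWalk.driftFormula z₀ (1 - z₀) 0 - 0.163379| < 0.0000005) := by
  refine ⟨fun p q hA x => ⟨fun h => ModularWalk.trafficEquations_unique hA h.1 h.2, ?_⟩, ?_, ?_⟩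
  · rintro rfl
    exact ⟨ModularWalk.trafficSolution_positiveProbability hA,
      ModularWalk.trafficSolution_trafficEquations hA⟩
  · intro p q hA Ω _ P _ ξ hξ
    have hM := ModularWalk.isMarkovMultiplicative_map_limitWord hA hξ
    exact ⟨ModularWalk.hasDrift_walk hA hξ, _, ModularWalk.isHarmonicMeasure_iff hA hξ, hM,
      hM.map_shift_ne (ModularWalk.trafficSolution_positiveProbability hA)
        (ModularWalk.trafficSolution_a_lt_half hA)⟩
  · obtain ⟨z, ⟨h1, h2⟩, huniq⟩ := ModularWalk.exists_unique_root
    refine ⟨z, ⟨h1, h2⟩, huniq, fun p q hA =>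
      ModularWalk.driftFormula_maximal h1 h2 ((huniq z h1 h2).2 rfl) hA, ?_⟩
    have hb := ModularWalk.driftFormula_boundary (p := 1 - z) (by linarith)
    rw [sub_sub_cancel] at hb
    rw [hb]
    exact ModularWalk.boundaryDrift_approx h1 h2
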